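/- Let $d\ge 1$ and let $U_1,U_2$ be unitary operators on $\mathbb{C}^d$, applied with prior probabilities $\eta_1,\eta_2\ge 0$, $\eta_1+\eta_2=1$. For an input state (density matrix) $\rho$ and a POVM $\{E_0,E_1,E_2\}$ (positive semidefinite operators with $E_0+E_1+E_2=1$; outcome $0$ is inconclusive), put $$P_\circ=\sum_{i}\eta_i\,\mathrm{tr}(U_i\rho U_i^\dagger E_i),\qquad P_\times=\sum_{i\neq j}\eta_i\,\mathrm{tr}(U_i\rho U_i^\dagger E_j)\quad(i,j\in\{1,2\}).$$ For $0\le m\le 1$ let $P_{\max}(m)$ be the maximum of $P_\circ$ over all $\rho$ and all POVMs subject to $P_\times\le m$, and let $P^{\mathrm{pure}}_{\max}(m)$ be the same maximum over pure inputs $\rho=|\phi\rangle\langle\phi|$ only. With $a=\min(\eta_1,\eta_2)$, $b=\max(\eta_1,\eta_2)$ and $S\in[0,1]$ define $$m_c=\tfrac12\bigl(1-\sqrt{1-4abS}\bigr),\qquad m_c'=\begin{cases}\dfrac{(a-\sqrt{abS})^2}{1-2\sqrt{abS}} & (a\le bS),\\[1ex] 0 & (a>bS),\end{cases}$$ (with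 $m_c'=0$ in the case $a=b=\tfrac12$, $S=1$, where the quotient is $0/0$) and $$P^{\mathrm{pure}}_{\max}(m,S)=\begin{cases}\tfrac12\bigl(1+\sqrt{1-4abS}\bigr) & (m_c\le m\le 1),\\ \bigl(\sqrt m+\sqrt{1-2\sqrt{abS}}\bigr)^2 & (m_c'\le m< m_c),\\ b\Bigl(\sqrt{\tfrac{m}{a}S}+\sqrt{\tfrac{a-m}{a}(1-S)}\Bigr)^2 & (0\le m<m_c').\end{cases}$$ Let $S_{\min}=\min_{\phi}|\langle\phi|U_1^\dagger U_2|\phi\rangle|^2$ over unit vectors $\phi$. Then: 1. The minimum $S_{\min}$ is attained and equals the squared distance from the origin to the convex hull of the eigenvalues of $U_1^\dagger U_2$ in the complex plane. 2. For each fixed pure input $\phi$ and each $m\in[0,1]$, the maximum of $P_\circ$ over POVMs with $P_\times\le m$ exists and equals $P^{\mathrm{pure}}_{\max}(m,S)$ with $S=|\langle\phi|U_1^\dagger U_2|\phi\rangle|^2$. 3. For all $m\in[0,1]$ the maxima exist and $P_{\max}(m)=P^{\mathrm{pure}}_{\max}(m)=P^{\mathrm{pure}}_{\max}(m,S_{\min})$;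 so pure inputs are optimal. 4. On $[0,1]\times[0,1]$, $P^{\mathrm{pure}}_{\max}(m,S)$ is concave and nondecreasing in $m$ and nonincreasing in $S$. 5. If the convex hull of the eigenvalues contains the origin, then $S_{\min}=0$ and $P_{\max}(m)=1$ for all $m\in[0,1]$. 6. An ancilla never helps: for every ancilla $R$ of finite dimension at least $1$, replacing $U_i$ by $U_i\otimes 1_R$, with arbitrary (possibly entangled) inputs and arbitrary POVMs on the composite system, changes neither $S_{\min}$ nor $P_{\max}(m)$ nor $P^{\mathrm{pure}}_{\max}(m)$. -/

import Mathlib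

open scoped Kronecker ComplexOrder

/-- A density matrix: a (generally mixed) quantum state of the system with basis `n`. -/
def IsDensityMatrix {n : Type*} [Fintype n] (ρ : Matrix n n ℂ) : Prop :=
  ρ.PosSemidef ∧ ρ.trace = 1

/-- The pure state `|φ⟩⟨φ|`. -/
def pureState {n : Type*} (φ : n → ℂ) : Matrix n n ℂ :=
  Matrix.vecMulVec φ (star φ)

/-- `φ` is a unit vector, `⟨φ|φ⟩ = 1`. -/
def IsUnitVector {n : Type*} [Fintype n] (φ : n → ℂ) : Prop :=
  star φ ⬝ᵥ φ = 1

/-- A POVM for discriminating processes labelled by `ι`: the outcome `some i` means that process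
`i` is guessed, the outcome `none` is the inconclusive one. -/
def IsPOVM {ι n : Type*} [Fintype ι] [Fintype n] [DecidableEq n]
    (E : Option ι → Matrix n n ℂ) : Prop :=
  (∀ μ, (E μ).PosSemidef) ∧ ∑ μ, E μ = 1

/-- The joint probability `η i * tr (U i ρ (U i)† E μ)` that the process is `i` and the
measurement outcome is `μ`. -/
noncomputable def jointProb {ι n : Type*} [Fintype n]
    (η : ι → ℝ) (U : ι → Matrix n n ℂ) (ρ : Matrix n n ℂ) (E : Option ι → Matrix n n ℂ)
    (i : ι) (μ : Option ι) : ℝ :=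
  η i * (U i * ρ * (U i).conjTranspose * E μ).trace.re

/-- The success probability of discrimination. -/
noncomputable def successProb {ι n : Type*} [Fintype ι] [Fintype n]
    (η : ι → ℝ) (U : ι → Matrix n n ℂ) (ρ : Matrix n n ℂ) (E : Option ι → Matrix n n ℂ) : ℝ :=
  ∑ i, jointProb η U ρ E i (some i)

/-- The mean probability of an erroneous guess. -/
noncomputable def errorProb {ι n : Type*} [Fintype ι] [DecidableEq ι] [Fintype n]
    (η : ι → ℝ) (U : ι → Matrix n n ℂ) (ρ : Matrix n n ℂ) (E : Option ι → Matrix n n ℂ) : ℝ :=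
  ∑ i, ∑ j ∈ Finset.univ.erase i, jointProb η U ρ E i (some j)

/-- Success probabilities that are attainable with error margin `m` for the fixed input `ρ`. -/
def successSetOfInput {ι n : Type*} [Fintype ι] [DecidableEq ι] [Fintype n] [DecidableEq n]
    (η : ι → ℝ) (U : ι → Matrix n n ℂ) (m : ℝ) (ρ : Matrix n n ℂ) : Set ℝ :=
  {p | ∃ E : Option ι → Matrix n n ℂ, IsPOVM E ∧ errorProb η U ρ E ≤ m ∧
    p = successProb η U ρ E}

/-- Success probabilities that are attainable with error margin `m` by an arbitrary input state
and an arbitrary POVM. -/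
def successSet {ι n : Type*} [Fintype ι] [DecidableEq ι] [Fintype n] [DecidableEq n]
    (η : ι → ℝ) (U : ι → Matrix n n ℂ) (m : ℝ) : Set ℝ :=
  {p | ∃ ρ : Matrix n n ℂ, IsDensityMatrix ρ ∧ p ∈ successSetOfInput η U m ρ}

/-- Success probabilities that are attainable with error margin `m` by a pure input state and an
arbitrary POVM. -/
def pureSuccessSet {ι n : Type*} [Fintype ι] [DecidableEq ι] [Fintype n] [DecidableEq n]
    (η : ι → ℝ) (U : ι → Matrix n n ℂ) (m : ℝ) : Set ℝ :=
  {p | ∃ φ : n → ℂ, IsUnitVector φ ∧ p ∈ successSetOfInput η U m (pureState φ)}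

/-- The processes `U i ⊗ 1` on the system together with an ancilla with basis `r`. -/
def withAncilla {ι n : Type*} (r : Type*) [DecidableEq r]
    (U : ι → Matrix n n ℂ) (i : ι) : Matrix (n × r) (n × r) ℂ :=
  U i ⊗ₖ (1 : Matrix r r ℂ)

/-- The critical error margin `m_c` (for priors `a ≤ b`). -/
noncomputable def critMargin (a b S : ℝ) : ℝ :=
  (1 - √(1 - 4 * a * b * S)) / 2

/-- The critical error margin `m_c'` (for priors `a ≤ b`). -/
noncomputable def critMargin' (a b S : ℝ) : ℝ :=
  if a ≤ b * S then (a - √(a * b * S)) ^ 2 / (1 - 2 * √(a * b * S)) else 0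

/-- The three-domain formula for priors `a ≤ b`: minimum-error, intermediate and single-state
domain. -/
noncomputable def threeDomainFormula (a b m S : ℝ) : ℝ :=
  if critMargin a b S ≤ m then (1 + √(1 - 4 * a * b * S)) / 2
  else if critMargin' a b S ≤ m then (√m + √(1 - 2 * √(a * b * S))) ^ 2
  else b * (√(m / a * S) + √((a - m) / a * (1 - S))) ^ 2

/-- The function `P_max^pure(m, S)` for two pure states with squared overlap `S` and priors
`η 0`, `η 1` in either order. -/
noncomputable def pureOptimum (η : Fin 2 → ℝ) (m S : ℝ) : ℝ :=
  threeDomainFormula (min (η 0) (η 1)) (max (η 0) (η 1)) m S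

/-- The values `|⟨φ| U₁† U₂ |φ⟩|²` over all unit vectors `φ`. -/
def overlapSet {n : Type*} [Fintype n] (U : Fin 2 → Matrix n n ℂ) : Set ℝ :=
  {s | ∃ φ : n → ℂ, IsUnitVector φ ∧
    s = ‖star φ ⬝ᵥ (((U 0).conjTranspose * U 1).mulVec φ)‖ ^ 2}

/-- `S_min`, the infimum (in fact minimum) of `|⟨φ| U₁† U₂ |φ⟩|²` over all unit vectors. -/
noncomputable def minOverlap {n : Type*} [Fintype n] (U : Fin 2 → Matrix n n ℂ) : ℝ :=
  sInf (overlapSet U)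

/-- The convex hull, in the complex plane, of the eigenvalues of `U₁† U₂`. -/
def eigenvalueHull {n : Type*} [Fintype n] [DecidableEq n] (U : Fin 2 → Matrix n n ℂ) : Set ℂ :=
  convexHull ℝ (spectrum ℂ ((U 0).conjTranspose * U 1))

/-!
The argument rests on one inequality. Let `ρ = C C†` be a pure or mixed input, let
`E μ = D μ† D μ` be a POVM and put `V = U₁† U₂`. The Cauchy–Schwarz inequality for the
Hilbert–Schmidt inner product, applied to `D μ U₁ C` and `D μ U₂ C` and summed over the outcomes
`μ`, bounds `|tr (ρ V)|` by the Bhattacharyya coefficient of the two outcome distributions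
(`norm_trace_le_sum_sqrt_mul_sqrt`). With squared overlap `S ≤ |tr (ρ V)|²` the discrimination
problem is thus relaxed to a problem about two vectors `x`, `y` in `ℝ³`, the square roots of the
joint probabilities, with `|x|² = a`, `|y|² = b` and `√(abS) ≤ x · y`.

*Upper bound* (`success_le_threeDomainFormula`). Exchanging the conclusive coordinates of `y`,
Cauchy–Schwarz and the inequality of the arithmetic and geometric mean give
`√P_success ≤ √P_error + √(1 - 2 √(abS))`, which contains both the intermediate and the
minimum-error domain. In the single-state domain the overlap constraint is linearised at the
optimal measurement, which never guesses the less likely process, and a quadratic form in two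
variables turns out to be negative semidefinite.

*Attainment* (`exists_amplitudes`, `exists_povm_of_amplitudes`). The relaxed problem has explicit
optimal amplitudes, with `x · y` exactly equal to `√(abS)`. For a pure input `φ` a contraction
carrying `U₁ φ`, `U₂ φ` to these amplitudes (up to a phase) exists because the Gram matrices agree,
and measuring in the standard basis after the contraction realises them.

*Inputs and ancillas.* Diagonalising the unitary `V` shows that `tr (ρ V)` lies in the convex hull
of the eigenvalues for every density matrix `ρ`, and that each point of the hull is attained by a
pure state. Hence the squared distance `S_min` of the hull from the origin is the least squared
overlap, bounds `|tr (ρ V)|²` from below for mixed inputs too, and so bounds the success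
probability of every input by the optimum at `S_min`. An ancilla changes only the multiplicities
of the eigenvalues, so it leaves the hull unchanged.

*Shape of the optimum.* Concavity and monotonicity in `m` follow by mixing POVMs for a fixed pure
input of a qubit; monotonicity in `S` holds because `S` enters the upper bound only through the
constraint `√(abS) ≤ x · y`.
-/

/-! ### The scalar optimisation problem: upper bound -/

/-- Cauchy–Schwarz for the conclusive outcomes and the arithmetic-geometric mean inequality for
the inconclusive one. -/
lemma sqrt_success_le {x₁ x₂ x₃ y₁ y₂ y₃ t : ℝ}
    (hsum : x₁ ^ 2 + x₂ ^ 2 + x₃ ^ 2 + (y₁ ^ 2 + y₂ ^ 2 + y₃ ^ 2) = 1)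
    (h : t ≤ x₁ * y₁ + x₂ * y₂ + x₃ * y₃) :
    √(x₁ ^ 2 + y₂ ^ 2) ≤ √(x₂ ^ 2 + y₁ ^ 2) + √(1 - 2 * t) := by
  set p := √(x₁ ^ 2 + y₂ ^ 2) with hp
  set q := √(x₂ ^ 2 + y₁ ^ 2) with hq
  have hp2 : p ^ 2 = x₁ ^ 2 + y₂ ^ 2 := Real.sq_sqrt (by positivity)
  have hq2 : q ^ 2 = x₂ ^ 2 + y₁ ^ 2 := Real.sq_sqrt (by positivity)
  have hcs : x₁ * y₁ + x₂ * y₂ ≤ p * q := by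
    refine (abs_le_of_sq_le_sq' ?_ (by positivity)).2
    rw [mul_pow, hp2, hq2]
    nlinarith [sq_nonneg (x₁ * x₂ - y₁ * y₂)]
  have : (p - q) ^ 2 ≤ 1 - 2 * t := by nlinarith [sq_nonneg (x₃ - y₃)]
  linarith [le_abs_self (p - q), Real.abs_le_sqrt this]

/-- The bound `√P ≤ √e + √(1 - 2t)` with the full error `e ≤ 1 - P` gives the minimum-error
(Helstrom) bound. -/
lemma success_le_minError {P e t : ℝ} (hP : 0 ≤ P) (he : 0 ≤ e) (hPe : P + e ≤ 1)
    (ht : 4 * t ^ 2 ≤ 1) (ht0 : 0 ≤ t) (h : √P ≤ √e + √(1 - 2 * t)) :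
    P ≤ (1 + √(1 - 4 * t ^ 2)) / 2 := by
  by_contra! hlt
  set r := √(1 - 4 * t ^ 2)
  have hr : r ^ 2 = 1 - 4 * t ^ 2 := Real.sq_sqrt (by linarith)
  have hr0 : 0 ≤ r := Real.sqrt_nonneg _
  have hs : √(1 - 2 * t) ^ 2 = 1 - 2 * t := Real.sq_sqrt (by nlinarith)
  have h1 : √P ≤ √(1 - P) + √(1 - 2 * t) := by
    have := Real.sqrt_le_sqrt (show e ≤ 1 - P by linarith)
    linarith
  have h2 : √(1 - P) ≤ √P := Real.sqrt_le_sqrt (by linarith)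
  have h3 : √P ^ 2 = P := Real.sq_sqrt hP
  have h4 : √(1 - P) ^ 2 = 1 - P := Real.sq_sqrt (by linarith)
  have h5 : (√P - √(1 - P)) ^ 2 ≤ 1 - 2 * t := by
    rw [← hs]
    exact pow_le_pow_left₀ (by linarith) (by linarith) 2
  have h6 : t ≤ √P * √(1 - P) := by nlinarith
  have h7 : t ^ 2 ≤ P * (1 - P) := by
    calc t ^ 2 ≤ (√P * √(1 - P)) ^ 2 := pow_le_pow_left₀ ht0 h6 2
      _ = _ := by rw [mul_pow, h3, h4]
  nlinarith

/-- The certificate of optimality in the single-state domain. `X` and `Y` are the amplitudes of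
the optimal measurement, which never guesses the less likely state; `Y₁ / X₁` and `Y₂ / X₂` are
the multipliers that linearise the overlap constraint, and `X₂ ≤ Y₂` makes the remaining
quadratic form in `x₁`, `y₁` negative semidefinite. -/
lemma success_le_singleState {x₁ x₂ x₃ y₁ y₂ y₃ X₁ X₂ Y₁ Y₂ : ℝ}
    (hX₁ : 0 < X₁) (hX₂ : 0 < X₂) (hD : X₁ * Y₂ < X₂ * Y₁) (hv : X₂ ≤ Y₂)
    (hx : x₁ ^ 2 + x₂ ^ 2 + x₃ ^ 2 = X₁ ^ 2 + X₂ ^ 2)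
    (hy : y₁ ^ 2 + y₂ ^ 2 + y₃ ^ 2 = Y₁ ^ 2 + Y₂ ^ 2)
    (h : X₁ * Y₁ + X₂ * Y₂ ≤ x₁ * y₁ + x₂ * y₂ + x₃ * y₃)
    (he : x₂ ^ 2 + y₁ ^ 2 ≤ X₁ ^ 2) :
    x₁ ^ 2 + y₂ ^ 2 ≤ Y₁ ^ 2 := by
  obtain ⟨u, rfl⟩ : ∃ u, Y₁ = u * X₁ := ⟨Y₁ / X₁, by field_simp⟩
  obtain ⟨v, rfl⟩ : ∃ v, Y₂ = v * X₂ := ⟨Y₂ / X₂, by field_simp⟩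
  have hv1 : 1 ≤ v := by
    by_contra! hlt
    nlinarith
  have huv : v < u := by
    by_contra! hle
    nlinarith [mul_pos hX₁ hX₂]
  have hu : 0 < u := by linarith
  have hv0 : 0 < v := by linarith
  have h2 : 2 * u * (x₂ * y₂) ≤ u ^ 2 * x₂ ^ 2 + y₂ ^ 2 := by nlinarith [sq_nonneg (u * x₂ - y₂)]
  have h3 : 2 * v * (x₃ * y₃) ≤ v ^ 2 * x₃ ^ 2 + y₃ ^ 2 := by nlinarith [sq_nonneg (v * x₃ - y₃)]
  set k := u * v ^ 2 - u + v with hk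
  set k' := u * v * (u - v) + u with hk'
  have hk0 : 0 < k := by
    have : k = u * ((v - 1) * (v + 1)) + v := by rw [hk]; ring
    rw [this]
    have h1 : 0 ≤ v - 1 := by linarith
    positivity
  have hdet : 0 ≤ k * k' - (u * v) ^ 2 := by
    have : k * k' - (u * v) ^ 2 = u * (u - v) * ((v - 1) * (v + 1)) * (u * v + 1) := by
      rw [hk, hk']; ring
    rw [this]
    have h1 : 0 ≤ u - v := by linarith
    have h2 : 0 ≤ v - 1 := by linarith
    positivity
  have hQ : 2 * u * v * (x₁ * y₁) - k * x₁ ^ 2 - k' * y₁ ^ 2 ≤ 0 := by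
    have : k * (2 * u * v * (x₁ * y₁) - k * x₁ ^ 2 - k' * y₁ ^ 2) ≤ 0 := by
      nlinarith [sq_nonneg (k * x₁ - u * v * y₁), mul_nonneg hdet (sq_nonneg y₁)]
    by_contra! hlt
    nlinarith
  have hmain : (u - v) * (x₁ ^ 2 + y₂ ^ 2 - (u * X₁) ^ 2 - u * v * (x₂ ^ 2 + y₁ ^ 2 - X₁ ^ 2))
      ≤ 2 * u * v * (x₁ * y₁) - k * x₁ ^ 2 - k' * y₁ ^ 2 := by
    have e3 : x₃ ^ 2 = X₁ ^ 2 + X₂ ^ 2 - x₁ ^ 2 - x₂ ^ 2 := by linarith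
    have e3' : y₃ ^ 2 = (u * X₁) ^ 2 + (v * X₂) ^ 2 - y₁ ^ 2 - y₂ ^ 2 := by linarith
    rw [e3, e3'] at h3
    have h' := mul_le_mul_of_nonneg_left h (show 0 ≤ 2 * u * v by positivity)
    have h2' := mul_le_mul_of_nonneg_left h2 hv0.le
    have h3' := mul_le_mul_of_nonneg_left h3 hu.le
    rw [hk, hk']
    nlinarith
  have h0 : x₁ ^ 2 + y₂ ^ 2 - (u * X₁) ^ 2 - u * v * (x₂ ^ 2 + y₁ ^ 2 - X₁ ^ 2) ≤ 0 := by
    by_contra! hlt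
    have := mul_pos (sub_pos.2 huv) hlt
    linarith
  have h1 : u * v * (x₂ ^ 2 + y₁ ^ 2 - X₁ ^ 2) ≤ 0 :=
    mul_nonpos_of_nonneg_of_nonpos (by positivity) (by linarith)
  linarith

/-- Unambiguous discrimination in the single-state domain. -/
lemma success_le_of_error_eq_zero {x₁ x₃ y₂ y₃ a b t : ℝ}
    (hx : x₁ ^ 2 + x₃ ^ 2 = a) (hy : y₂ ^ 2 + y₃ ^ 2 = b) (ha : 0 < a) (hat : a ≤ t)
    (h : t ≤ x₃ * y₃) : x₁ ^ 2 + y₂ ^ 2 ≤ b - t ^ 2 / a := by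
  have hta : t ^ 2 / a * a = t ^ 2 := by field_simp
  -- the multiplier is `t / a ≥ 1`
  have h1 : 0 ≤ (t * x₃ - a * y₃) ^ 2 := sq_nonneg _
  have h2 : a * (x₁ ^ 2 + y₂ ^ 2) ≤ a * (b - t ^ 2 / a) := by
    have h3 : 2 * t * t ≤ 2 * t * (x₃ * y₃) := by
      apply mul_le_mul_of_nonneg_left h; linarith
    have h4 : a ^ 2 * x₁ ^ 2 ≤ t ^ 2 * x₁ ^ 2 :=
      mul_le_mul_of_nonneg_right (pow_le_pow_left₀ ha.le hat 2) (sq_nonneg _)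
    have e3 : x₃ ^ 2 = a - x₁ ^ 2 := by linarith
    have e3' : y₃ ^ 2 = b - y₂ ^ 2 := by linarith
    have h5 : 2 * t * (x₃ * y₃) * a ≤ t ^ 2 * (a - x₁ ^ 2) + a ^ 2 * (b - y₂ ^ 2) := by
      rw [← e3, ← e3']; nlinarith
    have h6 := mul_le_mul_of_nonneg_right h3 ha.le
    have : a * (a * (x₁ ^ 2 + y₂ ^ 2)) ≤ a * (a * (b - t ^ 2 / a)) := by nlinarith
    exact le_of_mul_le_mul_left this ha
  exact le_of_mul_le_mul_left h2 ha

/-- Indistinguishable states: equality in Cauchy–Schwarz forces the outcome distributions to be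
proportional. -/
lemma success_le_of_overlap_eq_one {x₁ x₂ x₃ y₁ y₂ y₃ a b : ℝ}
    (hx : x₁ ^ 2 + x₂ ^ 2 + x₃ ^ 2 = a) (hy : y₁ ^ 2 + y₂ ^ 2 + y₃ ^ 2 = b)
    (ha : 0 < a) (hab : a ≤ b) (h : √a * √b ≤ x₁ * y₁ + x₂ * y₂ + x₃ * y₃) :
    x₁ ^ 2 + y₂ ^ 2 ≤ b / a * (x₂ ^ 2 + y₁ ^ 2) := by
  have ha2 : √a ^ 2 = a := Real.sq_sqrt ha.le
  have hb2 : √b ^ 2 = b := Real.sq_sqrt (by linarith)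
  have hsa : 0 < √a := Real.sqrt_pos.2 ha
  have hsb : 0 < √b := Real.sqrt_pos.2 (by linarith)
  have hz : (√b * x₁ - √a * y₁) ^ 2 + (√b * x₂ - √a * y₂) ^ 2 + (√b * x₃ - √a * y₃) ^ 2 ≤ 0 := by
    have := mul_le_mul_of_nonneg_left h (show 0 ≤ 2 * (√a * √b) by positivity)
    nlinarith
  have h1 : √b * x₁ = √a * y₁ := by
    nlinarith [sq_nonneg (√b * x₁ - √a * y₁), sq_nonneg (√b * x₂ - √a * y₂),
      sq_nonneg (√b * x₃ - √a * y₃)]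
  have h2 : √b * x₂ = √a * y₂ := by
    nlinarith [sq_nonneg (√b * x₁ - √a * y₁), sq_nonneg (√b * x₂ - √a * y₂),
      sq_nonneg (√b * x₃ - √a * y₃)]
  have e1 : b * x₁ ^ 2 = a * y₁ ^ 2 := by
    rw [← ha2, ← hb2, ← mul_pow, ← mul_pow, h1]
  have e2 : b * x₂ ^ 2 = a * y₂ ^ 2 := by
    rw [← ha2, ← hb2, ← mul_pow, ← mul_pow, h2]
  have h3 : x₁ ^ 2 ≤ b / a * y₁ ^ 2 := by
    rw [div_mul_eq_mul_div, le_div_iff₀ ha]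
    nlinarith [sq_nonneg x₁, sq_nonneg y₁]
  have h4 : y₂ ^ 2 = b / a * x₂ ^ 2 := by
    rw [div_mul_eq_mul_div, eq_div_iff ha.ne']
    linarith
  rw [h4]
  linarith

lemma four_mul_mul_mul_le_one {a b S : ℝ} (ha : 0 ≤ a) (hb : 0 ≤ b) (h1 : a + b = 1)
    (hS : S ≤ 1) : 4 * a * b * S ≤ 1 := by
  have : a * b * S ≤ a * b := by nlinarith [mul_nonneg ha hb]
  nlinarith [sq_nonneg (a - b)]

lemma two_mul_sqrt_le_one {a b S : ℝ} (ha : 0 ≤ a) (hb : 0 ≤ b) (h1 : a + b = 1)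
    (hS : S ≤ 1) : 2 * √(a * b * S) ≤ 1 := by
  have : √(a * b * S) ≤ 1 / 2 := by
    rw [Real.sqrt_le_left (by norm_num)]
    linarith [four_mul_mul_mul_le_one ha hb h1 hS]
  linarith

/-- The defining inequality of the single-state domain without the quotient. Where that quotient
is `0 / 0`, the domain is empty. -/
lemma lt_critMargin'_imp {a b m S : ℝ} (ha : 0 ≤ a) (hb : 0 ≤ b) (h1 : a + b = 1)
    (hS : S ≤ 1) (hm : 0 ≤ m) (h : m < critMargin' a b S) :
    a ≤ b * S ∧ m * (1 - 2 * √(a * b * S)) < (a - √(a * b * S)) ^ 2 := by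
  unfold critMargin' at h
  split_ifs at h with hc
  · refine ⟨hc, ?_⟩
    rcases (sub_nonneg.2 (two_mul_sqrt_le_one ha hb h1 hS)).eq_or_lt with h0 | h0
    · rw [← h0, div_zero] at h
      linarith
    · rwa [lt_div_iff₀ h0] at h
  · linarith

/-- Below the second critical margin the error margin is smaller than the smaller prior. -/
lemma lt_of_lt_critMargin' {a b m S : ℝ} (ha : 0 < a) (hb : 0 ≤ b) (h1 : a + b = 1)
    (hS0 : 0 ≤ S) (hS : S ≤ 1) (hm : 0 ≤ m) (h : m < critMargin' a b S) : m < a := by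
  obtain ⟨-, h2⟩ := lt_critMargin'_imp ha.le hb h1 hS hm h
  have ht : √(a * b * S) ^ 2 = a * b * S := Real.sq_sqrt (by positivity)
  have ht1 := two_mul_sqrt_le_one ha.le hb h1 hS
  have h3 : a * b * S ≤ a * b := by nlinarith [mul_nonneg ha.le hb]
  by_contra! hle
  have := mul_le_mul_of_nonneg_right hle (show 0 ≤ 1 - 2 * √(a * b * S) by linarith)
  nlinarith

/-- Below the second critical margin the inconclusive amplitude of the more likely state dominates
that of the less likely one, as `success_le_singleState` requires. -/
lemma singleState_amplitude_le {A B p q c s : ℝ} (hA : 0 < A) (hq : 0 ≤ q)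
    (hpq : p ^ 2 + q ^ 2 = 1) (hcs : c ^ 2 + s ^ 2 = 1) (hAB : A ≤ B * c)
    (h : A ^ 2 * p ^ 2 * (A ^ 2 + B ^ 2 - 2 * A * B * c) ≤ (A ^ 2 - A * B * c) ^ 2) :
    A * q ≤ B * (q * c - p * s) := by
  have h1 : p ^ 2 * (A ^ 2 + B ^ 2 - 2 * A * B * c) ≤ (A - B * c) ^ 2 := by
    refine le_of_mul_le_mul_left ?_ (pow_pos hA 2)
    calc _ = A ^ 2 * p ^ 2 * (A ^ 2 + B ^ 2 - 2 * A * B * c) := by ring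
      _ ≤ _ := h
      _ = _ := by ring
  have h2 : (B * p * s) ^ 2 ≤ ((B * c - A) * q) ^ 2 := by
    have e1 : s ^ 2 = 1 - c ^ 2 := by linarith
    have e2 : q ^ 2 = 1 - p ^ 2 := by linarith
    rw [mul_pow, mul_pow, mul_pow, e1, e2]
    linarith
  have h3 := (abs_le_of_sq_le_sq' h2 (mul_nonneg (by linarith) hq)).2
  linarith

/-- The optimal value of the scalar problem. The amplitudes `xⱼ`, `yⱼ` are square roots of the
joint probabilities of outcome `j` with the less likely, respectively more likely, state. Outcome
`1` guesses the less likely state, outcome `2` the more likely one, and outcome `3` is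
inconclusive. -/
theorem success_le_threeDomainFormula {a b m S x₁ x₂ x₃ y₁ y₂ y₃ : ℝ}
    (ha : 0 ≤ a) (hab : a ≤ b) (h1 : a + b = 1) (hS0 : 0 ≤ S) (hS : S ≤ 1)
    (hx : x₁ ^ 2 + x₂ ^ 2 + x₃ ^ 2 = a) (hy : y₁ ^ 2 + y₂ ^ 2 + y₃ ^ 2 = b)
    (h : √(a * b * S) ≤ x₁ * y₁ + x₂ * y₂ + x₃ * y₃) (he : x₂ ^ 2 + y₁ ^ 2 ≤ m) :
    x₁ ^ 2 + y₂ ^ 2 ≤ threeDomainFormula a b m S := by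
  have hb : 0 ≤ b := ha.trans hab
  have ht : √(a * b * S) ^ 2 = a * b * S := Real.sq_sqrt (by positivity)
  have h4 := four_mul_mul_mul_le_one ha hb h1 hS
  have key := sqrt_success_le (by linarith) h
  have hm : 0 ≤ m := le_trans (by positivity) he
  unfold threeDomainFormula
  split_ifs with hc hc'
  · have := success_le_minError (by positivity) (by positivity)
      (by nlinarith [sq_nonneg x₃, sq_nonneg y₃]) (by linarith) (Real.sqrt_nonneg _) key
    rwa [ht, ← mul_assoc, ← mul_assoc] at this
  · have h2 : √(x₁ ^ 2 + y₂ ^ 2) ≤ √m + √(1 - 2 * √(a * b * S)) :=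
      key.trans (by gcongr)
    calc x₁ ^ 2 + y₂ ^ 2 = √(x₁ ^ 2 + y₂ ^ 2) ^ 2 := (Real.sq_sqrt (by positivity)).symm
      _ ≤ _ := pow_le_pow_left₀ (Real.sqrt_nonneg _) h2 2
  · rw [not_le] at hc hc'
    obtain ⟨haS, hlt⟩ := lt_critMargin'_imp ha hb h1 hS hm hc'
    have ha0 : 0 < a := by
      refine ha.lt_of_ne fun h0 => ?_
      subst h0
      simp [critMargin] at hc
      linarith
    have hma := lt_of_lt_critMargin' ha0 hb h1 hS0 hS hm hc'
    have hb0 : 0 < b := by linarith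
    have hat : a ≤ √(a * b * S) := by
      apply Real.le_sqrt_of_sq_le
      nlinarith
    -- the trigonometric parametrisation of the optimal amplitudes
    set p := √(m / a) with hp
    set q := √((a - m) / a) with hq
    set c := √S with hcS
    set s := √(1 - S) with hs
    have hp2 : p ^ 2 = m / a := Real.sq_sqrt (by positivity)
    have hq2 : q ^ 2 = (a - m) / a := Real.sq_sqrt (div_nonneg (by linarith) ha)
    have hc2 : c ^ 2 = S := Real.sq_sqrt hS0
    have hs2 : s ^ 2 = 1 - S := Real.sq_sqrt (by linarith)
    have hpq : p ^ 2 + q ^ 2 = 1 := by rw [hp2, hq2]; field_simp; ring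
    have hcs : c ^ 2 + s ^ 2 = 1 := by rw [hc2, hs2]; ring
    have hpm : a * p ^ 2 = m := by rw [hp2]; field_simp
    have hA2 : √a ^ 2 = a := Real.sq_sqrt ha
    have hB2 : √b ^ 2 = b := Real.sq_sqrt hb
    have hA0 : 0 < √a := Real.sqrt_pos.2 ha0
    have hB0 : 0 < √b := Real.sqrt_pos.2 hb0
    have htc : √(a * b * S) = √a * √b * c := by
      rw [Real.sqrt_mul (by positivity), Real.sqrt_mul ha]
    rw [Real.sqrt_mul (by positivity), Real.sqrt_mul (div_nonneg (by linarith) ha), ← hp, ← hq,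
      ← hcS, ← hs]
    have hc0 : 0 ≤ c := Real.sqrt_nonneg _
    have hs0 : 0 ≤ s := Real.sqrt_nonneg _
    have hp0 : 0 ≤ p := Real.sqrt_nonneg _
    have hq0 : 0 < q := Real.sqrt_pos.2 (div_pos (by linarith) ha0)
    -- the certificate of `success_le_singleState` degenerates for `S = 1` and for `m = 0`
    rcases hS.eq_or_lt with hS1 | hS1
    · have h2 : s = 0 := by rw [hs, hS1]; simp
      have h3 : c = 1 := by rw [hcS, hS1]; simp
      have := success_le_of_overlap_eq_one hx hy ha0 hab
        (by rw [← mul_one (√a * √b), ← h3, ← htc]; exact h)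
      calc _ ≤ _ := this
        _ ≤ b / a * m := by gcongr
        _ = _ := by rw [h2, h3, ← hpm]; field_simp; ring
    rcases hm.eq_or_lt with hm0 | hm0
    · have e1 : y₁ = 0 :=
        pow_eq_zero_iff two_ne_zero |>.1 (by
          linarith [sq_nonneg y₁, sq_nonneg x₂])
      have e2 : x₂ = 0 :=
        pow_eq_zero_iff two_ne_zero |>.1 (by
          linarith [sq_nonneg y₁, sq_nonneg x₂])
      subst e1 e2
      have := success_le_of_error_eq_zero (by simpa using hx) (by simpa using hy) ha0 hat
        (by simpa using h)
      refine this.trans (le_of_eq ?_)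
      have h2 : p = 0 := by rw [hp, ← hm0]; simp
      rw [h2] at hpq ⊢
      have h3 : b * (0 * c + q * s) ^ 2 = b * (q ^ 2 * s ^ 2) := by ring
      rw [h3, ht, hs2, show q ^ 2 = 1 by linarith]
      field_simp
    have hs1 : 0 < s := Real.sqrt_pos.2 (by linarith)
    have hp1 : 0 < p := Real.sqrt_pos.2 (by positivity)
    have hv : √a * q ≤ √b * (q * c - p * s) := by
      refine singleState_amplitude_le hA0 hq0.le hpq hcs ?_ ?_
      · rw [← Real.sqrt_mul hb]
        exact Real.sqrt_le_sqrt haS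
      · rw [htc, ← hpm, ← h1] at hlt
        rw [hA2, hB2, mul_assoc 2, mul_assoc 2]
        exact hlt.le
    have := success_le_singleState (X₁ := √a * p) (X₂ := √a * q) (Y₁ := √b * (p * c + q * s))
      (Y₂ := √b * (q * c - p * s)) (x₁ := x₁) (x₂ := x₂) (x₃ := x₃) (y₁ := y₁) (y₂ := y₂)
      (y₃ := y₃) (by positivity) (by positivity) ?_ hv ?_ ?_ ?_ ?_
    · rwa [mul_pow, hB2] at this
    · have : √a * q * (√b * (p * c + q * s)) - √a * p * (√b * (q * c - p * s))
          = √a * √b * s * (p ^ 2 + q ^ 2) := by ring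
      rw [hpq] at this
      have h5 : 0 < √a * √b * s * 1 := by positivity
      linarith
    · rw [hx, mul_pow, mul_pow, ← mul_add, hpq, hA2, mul_one]
    · have : (√b * (p * c + q * s)) ^ 2 + (√b * (q * c - p * s)) ^ 2
          = √b ^ 2 * ((p ^ 2 + q ^ 2) * (c ^ 2 + s ^ 2)) := by ring
      rw [hy, this, hpq, hcs, hB2]; ring
    · refine le_trans (le_of_eq ?_) h
      rw [htc]
      calc _ = √a * √b * c * (p ^ 2 + q ^ 2) := by ring
        _ = _ := by rw [hpq, mul_one]
    · rwa [mul_pow, hA2, hpm]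

/-! ### The scalar optimisation problem: attainment -/

/-- Amplitudes whose conclusive parts are proportional after exchanging the roles of the two
states, and whose inconclusive parts coincide; this is the equality case of `sqrt_success_le`. -/
lemma exists_amplitudes_of_balance {a b S P q w : ℝ} (ha : 0 < a) (hb : 0 < b) (h1 : a + b = 1)
    (hP : 0 ≤ P) (hq : 0 ≤ q) (hPq : P + q ≤ 1) (hw0 : 0 ≤ w) (hw1 : w ≤ 1)
    (hw : w * (P - q) = b - a) (ht : √P * √q + (1 - P - q) / 2 = √(a * b * S)) :
    ∃ x₁ x₂ x₃ y₁ y₂ y₃ : ℝ, x₁ ^ 2 + x₂ ^ 2 + x₃ ^ 2 = 1 ∧ y₁ ^ 2 + y₂ ^ 2 + y₃ ^ 2 = 1 ∧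
      x₁ * y₁ + x₂ * y₂ + x₃ * y₃ = √S ∧ a * x₂ ^ 2 + b * y₁ ^ 2 = q ∧
      a * x₁ ^ 2 + b * y₂ ^ 2 = P := by
  have hP2 : √P ^ 2 = P := Real.sq_sqrt hP
  have hq2 : √q ^ 2 = q := Real.sq_sqrt hq
  have hA2 : √a ^ 2 = a := Real.sq_sqrt ha.le
  have hB2 : √b ^ 2 = b := Real.sq_sqrt hb.le
  have hA0 : 0 < √a := Real.sqrt_pos.2 ha
  have hB0 : 0 < √b := Real.sqrt_pos.2 hb
  obtain ⟨f, hf⟩ : ∃ f : ℝ, f ^ 2 = (1 - w) / 2 := ⟨_, Real.sq_sqrt (by linarith)⟩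
  obtain ⟨g, hg⟩ : ∃ g : ℝ, g ^ 2 = (1 + w) / 2 := ⟨_, Real.sq_sqrt (by linarith)⟩
  obtain ⟨z, hz⟩ : ∃ z : ℝ, z ^ 2 = (1 - P - q) / 2 := ⟨_, Real.sq_sqrt (by linarith)⟩
  have htc : √(a * b * S) = √a * √b * √S := by
    rw [Real.sqrt_mul (by positivity), Real.sqrt_mul ha.le]
  refine ⟨√P * f / √a, √q * g / √a, z / √a, √q * f / √b, √P * g / √b, z / √b, ?_, ?_, ?_, ?_, ?_⟩
  · simp only [div_pow, mul_pow, hP2, hq2, hA2, hf, hg, hz]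
    rw [← add_div, ← add_div, div_eq_one_iff_eq ha.ne']
    linarith
  · simp only [div_pow, mul_pow, hP2, hq2, hB2, hf, hg, hz]
    rw [← add_div, ← add_div, div_eq_one_iff_eq hb.ne']
    linarith
  · calc _ = (√P * √q * (f ^ 2 + g ^ 2) + z ^ 2) / (√a * √b) := by field_simp
      _ = _ := by
        rw [hf, hg, hz, div_eq_iff (by positivity), mul_comm (√S), ← htc, ← ht]
        ring
  · simp only [div_pow, mul_pow, hq2, hA2, hB2, hf, hg]
    field_simp
    ring
  · simp only [div_pow, mul_pow, hP2, hA2, hB2, hf, hg]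
    field_simp
    ring

lemma critMargin_mem {a b S : ℝ} (ha : 0 ≤ a) (hb : 0 ≤ b) (h1 : a + b = 1) (hS0 : 0 ≤ S)
    (hS : S ≤ 1) : 0 ≤ critMargin a b S ∧ 2 * critMargin a b S ≤ 1 ∧
      critMargin a b S * (1 - critMargin a b S) = a * b * S := by
  have h4 := four_mul_mul_mul_le_one ha hb h1 hS
  have hr : √(1 - 4 * a * b * S) ^ 2 = 1 - 4 * a * b * S := Real.sq_sqrt (by linarith)
  have hr1 : √(1 - 4 * a * b * S) ≤ 1 := Real.sqrt_le_one.2 (by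
    have : 0 ≤ a * b * S := by positivity
    linarith)
  have hr0 : 0 ≤ √(1 - 4 * a * b * S) := Real.sqrt_nonneg _
  unfold critMargin
  refine ⟨by linarith, by linarith, ?_⟩
  calc _ = (1 - √(1 - 4 * a * b * S) ^ 2) / 4 := by ring
    _ = _ := by rw [hr]; ring

/-- `√(1 - m_c) = √m_c + √(1 - 2 √(abS))`: the intermediate domain joins the minimum-error
domain continuously. -/
lemma sqrt_one_sub_critMargin {a b S : ℝ} (ha : 0 ≤ a) (hb : 0 ≤ b) (h1 : a + b = 1)
    (hS0 : 0 ≤ S) (hS : S ≤ 1) :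
    √(1 - critMargin a b S) = √(critMargin a b S) + √(1 - 2 * √(a * b * S)) := by
  obtain ⟨h0, h2, h3⟩ := critMargin_mem ha hb h1 hS0 hS
  set M := critMargin a b S
  have e1 : √(1 - M) ^ 2 = 1 - M := Real.sq_sqrt (by linarith)
  have e2 : √M ^ 2 = M := Real.sq_sqrt h0
  have e3 : √(a * b * S) = √M * √(1 - M) := by rw [← h3, Real.sqrt_mul h0]
  have e4 : √M ≤ √(1 - M) := Real.sqrt_le_sqrt (by linarith)
  have : 1 - 2 * √(a * b * S) = (√(1 - M) - √M) ^ 2 := by rw [e3]; linarith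
  rw [this, Real.sqrt_sq (by linarith)]
  ring

lemma sub_le_sqrt_one_sub {a b S : ℝ} (ha : 0 ≤ a) (hb : 0 ≤ b) (h1 : a + b = 1)
    (hS : S ≤ 1) : b - a ≤ √(1 - 4 * a * b * S) := by
  apply Real.le_sqrt_of_sq_le
  have : a * b * S ≤ a * b := by nlinarith [mul_nonneg ha hb]
  nlinarith

/-- In case `e = 0` the weight is needed too, so it is not written as the quotient `d / e`. -/
lemma exists_weight {d e : ℝ} (hd : 0 ≤ d) (hde : d ≤ e) :
    ∃ w : ℝ, 0 ≤ w ∧ w ≤ 1 ∧ w * e = d := by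
  rcases hd.eq_or_lt with rfl | hd0
  · exact ⟨0, by simp⟩
  · have he : 0 < e := by linarith
    exact ⟨d / e, by positivity, (div_le_one he).2 hde, by field_simp⟩

/-- The bound `success_le_threeDomainFormula` is attained. -/
theorem exists_amplitudes {a b m S : ℝ} (ha : 0 ≤ a) (hab : a ≤ b) (h1 : a + b = 1)
    (hS0 : 0 ≤ S) (hS : S ≤ 1) (hm : 0 ≤ m) :
    ∃ x₁ x₂ x₃ y₁ y₂ y₃ : ℝ, x₁ ^ 2 + x₂ ^ 2 + x₃ ^ 2 = 1 ∧ y₁ ^ 2 + y₂ ^ 2 + y₃ ^ 2 = 1 ∧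
      x₁ * y₁ + x₂ * y₂ + x₃ * y₃ = √S ∧ a * x₂ ^ 2 + b * y₁ ^ 2 ≤ m ∧
      a * x₁ ^ 2 + b * y₂ ^ 2 = threeDomainFormula a b m S := by
  have hb : 0 < b := by linarith
  have ht : √(a * b * S) ^ 2 = a * b * S := Real.sq_sqrt (by positivity)
  have ht1 := two_mul_sqrt_le_one ha hb.le h1 hS
  have ht0 := Real.sqrt_nonneg (a * b * S)
  rcases ha.eq_or_lt with rfl | ha0
  · -- the less likely state never occurs, so the other one is always guessed
    refine ⟨0, √S, √(1 - S), 0, 1, 0, ?_, by norm_num, by ring, by simpa using hm, ?_⟩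
    · rw [Real.sq_sqrt hS0, Real.sq_sqrt (by linarith)]; ring
    · simp [threeDomainFormula, critMargin, hm]
      linarith
  obtain ⟨hM0, hM1, hM⟩ := critMargin_mem ha hb.le h1 hS0 hS
  have hs := sqrt_one_sub_critMargin ha hb.le h1 hS0 hS
  have hs2 : √(1 - 2 * √(a * b * S)) ^ 2 = 1 - 2 * √(a * b * S) := Real.sq_sqrt (by linarith)
  have hs0 : 0 ≤ √(1 - 2 * √(a * b * S)) := Real.sqrt_nonneg _
  unfold threeDomainFormula
  split_ifs with hc hc'
  · obtain ⟨w, hw0, hw1, hw⟩ := exists_weight (sub_nonneg.2 hab)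
      (sub_le_sqrt_one_sub ha hb.le h1 hS)
    have hP : (1 + √(1 - 4 * a * b * S)) / 2 = 1 - critMargin a b S := by
      unfold critMargin; ring
    obtain ⟨x₁, x₂, x₃, y₁, y₂, y₃, hx, hy, hxy, he, hs⟩ := exists_amplitudes_of_balance
      (P := 1 - critMargin a b S) (q := critMargin a b S) (w := w) (S := S) ha0 hb h1 (by linarith)
      hM0 (by linarith) hw0 hw1
      (by rw [← hw]; unfold critMargin; ring)
      (by rw [← Real.sqrt_mul (by linarith), mul_comm, hM]; ring)
    exact ⟨x₁, x₂, x₃, y₁, y₂, y₃, hx, hy, hxy, he.le.trans hc, hs.trans hP.symm⟩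
  · rw [not_le] at hc
    set s := √(1 - 2 * √(a * b * S))
    have hm2 : √m ^ 2 = m := Real.sq_sqrt hm
    have hm0 : 0 ≤ √m := Real.sqrt_nonneg m
    have hsm : √m + s ≤ √(1 - critMargin a b S) := by
      rw [hs]; gcongr
    have hsum : (√m + s) ^ 2 + m ≤ 1 := by
      have h2 := pow_le_pow_left₀ (by positivity) hsm 2
      rw [Real.sq_sqrt (by linarith)] at h2
      linarith
    -- the lower end of the intermediate domain is where the balanced amplitudes stop existing
    have hgap : √(a * b * S) - a ≤ s * √m := by
      unfold critMargin' at hc'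
      split_ifs at hc' with haS
      · rcases hs0.eq_or_lt with h0 | h0
        · -- this happens only for `a = b = 1 / 2` and `S = 1`
          have h5 : √(a * b * S) = 1 / 2 := by
            rw [← h0] at hs2; linarith
          have h7 : a * b * S ≤ a * b := by nlinarith [mul_nonneg ha hb.le]
          rw [h5] at ht
          have h8 : a = 1 / 2 := by nlinarith [sq_nonneg (a - b)]
          rw [h5, h8, ← h0]; simp
        · have h5 : (a - √(a * b * S)) ^ 2 ≤ (s * √m) ^ 2 := by
            rw [mul_pow, hs2, hm2, mul_comm (1 - _)]
            rwa [div_le_iff₀ (by rw [← hs2]; positivity)] at hc'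
          have := (abs_le_of_sq_le_sq' h5 (by positivity)).1
          linarith
      · have : √(a * b * S) ≤ a := by
          rw [Real.sqrt_le_left ha]
          nlinarith
        have := mul_nonneg hs0 hm0
        linarith
    obtain ⟨w, hw0, hw1, hw⟩ := exists_weight (sub_nonneg.2 hab)
      (show b - a ≤ (√m + s) ^ 2 - m by nlinarith)
    obtain ⟨x₁, x₂, x₃, y₁, y₂, y₃, hx, hy, hxy, he, hs⟩ := exists_amplitudes_of_balance
      (P := (√m + s) ^ 2) (q := m) (w := w) (S := S) ha0 hb h1 (by positivity)
      hm hsum hw0 hw1 hw (by rw [Real.sqrt_sq (by positivity)]; nlinarith)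
    exact ⟨x₁, x₂, x₃, y₁, y₂, y₃, hx, hy, hxy, he.le, hs⟩
  · rw [not_le] at hc'
    have hma := lt_of_lt_critMargin' ha0 hb.le h1 hS0 hS hm hc'
    have ha' : 0 ≤ (a - m) / a := div_nonneg (by linarith) ha
    rw [Real.sqrt_mul (by positivity), Real.sqrt_mul ha']
    have hp2 : √(m / a) ^ 2 = m / a := Real.sq_sqrt (by positivity)
    have hq2 : √((a - m) / a) ^ 2 = (a - m) / a := Real.sq_sqrt ha'
    have hc2 : √S ^ 2 = S := Real.sq_sqrt hS0
    have hs2 : √(1 - S) ^ 2 = 1 - S := Real.sq_sqrt (by linarith)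
    set p := √(m / a)
    set q := √((a - m) / a)
    have hpq : p ^ 2 + q ^ 2 = 1 := by rw [hp2, hq2]; field_simp; ring
    refine ⟨0, p, q, 0, p * √S + q * √(1 - S), q * √S - p * √(1 - S), ?_, ?_, ?_, ?_, ?_⟩
    · linarith
    · calc _ = (p ^ 2 + q ^ 2) * (√S ^ 2 + √(1 - S) ^ 2) := by ring
        _ = 1 := by rw [hpq, hc2, hs2]; ring
    · calc _ = (p ^ 2 + q ^ 2) * √S := by ring
        _ = √S := by rw [hpq, one_mul]
    · rw [hp2]
      apply le_of_eq
      field_simp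
      ring
    · ring

/-! ### Diagonalisation of unitary matrices and the numerical range -/

section Isometry

open Module.End

variable {E : Type*} [NormedAddCommGroup E] [InnerProductSpace ℂ E] {T : E →ₗ[ℂ] E}

lemma conj_mul_eigenvalue_of_isometry (hT : ∀ v w, inner ℂ (T v) (T w) = inner ℂ v w) {μ : ℂ}
    {v : E} (hv : v ∈ eigenspace T μ) (hv0 : v ≠ 0) : star μ * μ = 1 := by
  have h := hT v v
  rw [mem_eigenspace_iff] at hv
  rw [hv, inner_smul_left, inner_smul_right, ← mul_assoc] at h
  exact mul_right_cancel₀ (inner_self_ne_zero.2 hv0) (h.trans (one_mul _).symm)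

lemma orthogonalFamily_eigenspaces_of_isometry
    (hT : ∀ v w, inner ℂ (T v) (T w) = inner ℂ v w) :
    OrthogonalFamily ℂ (fun μ => eigenspace T μ) fun μ => (eigenspace T μ).subtypeₗᵢ := by
  rintro μ ν hμν ⟨v, hv⟩ ⟨w, hw⟩
  by_cases hv' : v = 0
  · simp [hv']
  have h1 := conj_mul_eigenvalue_of_isometry hT hv hv'
  have h := hT v w
  rw [mem_eigenspace_iff] at hv hw
  rw [hv, hw, inner_smul_left, inner_smul_right] at h
  change inner ℂ v w = 0
  by_contra h0
  have h2 : star μ * ν = 1 :=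
    mul_right_cancel₀ h0 (by rw [one_mul, mul_assoc]; exact h)
  have hμ : star μ ≠ 0 := left_ne_zero_of_mul_eq_one h1
  exact hμν (mul_left_cancel₀ hμ (h1.trans h2.symm))

lemma invariant_orthogonal_eigenspace_of_isometry
    (hT : ∀ v w, inner ℂ (T v) (T w) = inner ℂ v w) (μ : ℂ) (v : E)
    (hv : v ∈ (eigenspace T μ)ᗮ) : T v ∈ (eigenspace T μ)ᗮ := by
  intro w hw
  by_cases hw' : w = 0
  · simp [hw']
  have h1 := conj_mul_eigenvalue_of_isometry hT hw hw'
  have h := hT w v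
  rw [hv w hw] at h
  rw [mem_eigenspace_iff] at hw
  rw [hw, inner_smul_left] at h
  exact (mul_eq_zero.1 h).resolve_left (left_ne_zero_of_mul_eq_one h1)

/-- The orthogonal complement of the sum of the eigenspaces is invariant, so it would contain an
eigenvector if it were nonzero. -/
lemma isInternal_eigenspaces_of_isometry [FiniteDimensional ℂ E]
    (hT : ∀ v w, inner ℂ (T v) (T w) = inner ℂ v w) :
    DirectSum.IsInternal fun μ : Eigenvalues T => eigenspace T μ := by
  have hinv : ∀ v ∈ (⨆ μ, eigenspace T μ)ᗮ, T v ∈ (⨆ μ, eigenspace T μ)ᗮ := by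
    intro v hv
    rw [← Submodule.iInf_orthogonal] at hv ⊢
    exact T.iInf_invariant (invariant_orthogonal_eigenspace_of_isometry hT) v hv
  have hbot : (⨆ μ, eigenspace T μ)ᗮ = ⊥ := by
    by_contra hne
    have : Nontrivial ((⨆ μ, eigenspace T μ)ᗮ : Submodule ℂ E) :=
      Submodule.nontrivial_iff_ne_bot.2 hne
    obtain ⟨μ, hμ⟩ := exists_eigenvalue (T.restrict hinv)
    refine hμ (eigenspace_restrict_eq_bot hinv ?_)
    exact ((Submodule.isOrtho_orthogonal_right _).mono_left (le_iSup _ μ)).disjoint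
  refine ((orthogonalFamily_eigenspaces_of_isometry hT).comp
    Subtype.coe_injective).isInternal_iff.2 ?_
  change (⨆ μ : { μ // eigenspace T μ ≠ ⊥ }, eigenspace T μ)ᗮ = ⊥
  rw [iSup_ne_bot_subtype, hbot]

end Isometry

section Matrix

variable {n : Type*} [Fintype n] [DecidableEq n]

/-- Unitary matrices are unitarily diagonalisable. -/
theorem exists_unitary_eq_diagonal {V : Matrix n n ℂ} (hV : V ∈ Matrix.unitaryGroup n ℂ) :
    ∃ W ∈ Matrix.unitaryGroup n ℂ, ∃ d : n → ℂ,
      V = W * Matrix.diagonal d * W.conjTranspose := by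
  set T := Matrix.toEuclideanLin V with hTdef
  have hT : ∀ v w, inner ℂ (T v) (T w) = inner ℂ v w := by
    intro v w
    simp only [EuclideanSpace.inner_eq_star_dotProduct, hTdef, Matrix.toLpLin_apply]
    rw [Matrix.star_mulVec, dotProduct_comm, ← Matrix.dotProduct_mulVec, Matrix.mulVec_mulVec,
      ← Matrix.star_eq_conjTranspose, Matrix.mem_unitaryGroup_iff'.1 hV, Matrix.one_mulVec,
      dotProduct_comm]
  have hn : Module.finrank ℂ (EuclideanSpace ℂ n) = Fintype.card n := finrank_euclideanSpace
  have hint := isInternal_eigenspaces_of_isometry hT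
  have hort : OrthogonalFamily ℂ (fun μ : Module.End.Eigenvalues T => Module.End.eigenspace T μ)
      fun μ => (Module.End.eigenspace T μ).subtypeₗᵢ :=
    (orthogonalFamily_eigenspaces_of_isometry hT).comp Subtype.coe_injective
  set b := (hint.subordinateOrthonormalBasis hn hort).reindex (Fintype.equivFin n).symm with hb
  have hd : ∀ j, ∃ μ : ℂ, T (b j) = μ • b j := by
    intro j
    have h := hint.subordinateOrthonormalBasis_subordinate hn (Fintype.equivFin n j) hort
    have hbj : b j = hint.subordinateOrthonormalBasis hn hort (Fintype.equivFin n j) := by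
      rw [hb, OrthonormalBasis.reindex_apply]
      rfl
    rw [← hbj] at h
    exact ⟨_, Module.End.mem_eigenspace_iff.1 h⟩
  choose d hd using hd
  let W : Matrix n n ℂ := Matrix.of fun i j => b j i
  have hW : W ∈ Matrix.unitaryGroup n ℂ := by
    rw [Matrix.mem_unitaryGroup_iff']
    ext j k
    have := orthonormal_iff_ite.1 b.orthonormal j k
    rw [EuclideanSpace.inner_eq_star_dotProduct, dotProduct_comm] at this
    rw [Matrix.one_apply, ← this]
    rfl
  have hVW : V * W = W * Matrix.diagonal d := by
    ext i j
    have := congrArg (fun v : EuclideanSpace ℂ n => v i) (hd j)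
    rw [Matrix.mul_diagonal, mul_comm]
    exact this
  refine ⟨W, hW, d, ?_⟩
  rw [← hVW, mul_assoc, ← Matrix.star_eq_conjTranspose, Matrix.mem_unitaryGroup_iff.1 hW, mul_one]

lemma spectrum_unitary_conj {W : Matrix n n ℂ} (hW : W ∈ Matrix.unitaryGroup n ℂ) (d : n → ℂ) :
    spectrum ℂ (W * Matrix.diagonal d * W.conjTranspose) = Set.range d := by
  have h := spectrum.units_conjugate (R := ℂ) (a := Matrix.diagonal d)
    (u := Unitary.toUnits ⟨W, hW⟩)
  rw [spectrum_diagonal] at h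
  exact h

/-- The mean value `tr (ρ V)` of a unitary is a convex combination of its eigenvalues. -/
theorem trace_mul_mem_convexHull_spectrum {V : Matrix n n ℂ} (hV : V ∈ Matrix.unitaryGroup n ℂ)
    {ρ : Matrix n n ℂ} (hρ : IsDensityMatrix ρ) :
    (ρ * V).trace ∈ convexHull ℝ (spectrum ℂ V) := by
  obtain ⟨W, hW, d, rfl⟩ := exists_unitary_eq_diagonal hV
  rw [spectrum_unitary_conj hW]
  set σ := W.conjTranspose * ρ * W with hσ
  have hσ0 : σ.PosSemidef := hρ.1.conjTranspose_mul_mul_same W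
  have hσd : ∀ i, ((σ i i).re : ℂ) = σ i i := fun i =>
    (Complex.eq_re_of_ofReal_le hσ0.diag_nonneg).symm
  have hσ1 : σ.trace = 1 := by
    rw [hσ, Matrix.trace_mul_comm, ← mul_assoc, ← Matrix.star_eq_conjTranspose,
      Matrix.mem_unitaryGroup_iff.1 hW, one_mul, hρ.2]
  refine mem_convexHull_of_exists_fintype (fun i => (σ i i).re) d
    (fun i => (Complex.nonneg_iff.1 hσ0.diag_nonneg).1) ?_ (fun i => ⟨i, rfl⟩) ?_
  · have := congrArg Complex.re hσ1
    simpa [Matrix.trace] using this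
  · have : (ρ * (W * Matrix.diagonal d * W.conjTranspose)).trace
        = (σ * Matrix.diagonal d).trace := by
      rw [hσ, ← mul_assoc, Matrix.trace_mul_comm]
      simp only [mul_assoc]
    rw [this]
    simp only [Matrix.trace, Matrix.diag_apply, Matrix.mul_diagonal, Complex.real_smul, hσd]

/-- Every point of the hull of the eigenvalues of a unitary is the mean value in a pure state. -/
theorem exists_unit_vector_of_mem_convexHull_spectrum {V : Matrix n n ℂ}
    (hV : V ∈ Matrix.unitaryGroup n ℂ) {z : ℂ} (hz : z ∈ convexHull ℝ (spectrum ℂ V)) :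
    ∃ φ : n → ℂ, IsUnitVector φ ∧ star φ ⬝ᵥ V.mulVec φ = z := by
  obtain ⟨W, hW, d, rfl⟩ := exists_unitary_eq_diagonal hV
  rw [spectrum_unitary_conj hW] at hz
  obtain ⟨w, ⟨hw0, hw1⟩, hwz⟩ : ∃ w ∈ stdSimplex ℝ n, ∑ i, w i • d i = z := by
    have hsub : convexHull ℝ (Set.range d) ⊆ (Fintype.linearCombination ℝ d) '' stdSimplex ℝ n := by
      refine convexHull_min ?_ ((convex_stdSimplex ℝ n).linear_image _)
      rintro _ ⟨i, rfl⟩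
      exact ⟨Pi.single i 1, single_mem_stdSimplex ℝ i, by simp⟩
    obtain ⟨w, hw, h⟩ := hsub hz
    exact ⟨w, hw, by rw [← h, Fintype.linearCombination_apply]⟩
  let ψ : n → ℂ := fun i => (√(w i) : ℂ)
  have hψ : ∀ i, star (ψ i) * ψ i = (w i : ℂ) := by
    intro i
    simp only [ψ, RCLike.star_def, Complex.conj_ofReal]
    rw [← Complex.ofReal_mul, Real.mul_self_sqrt (hw0 i)]
  have hWW : W.conjTranspose * W = 1 := Matrix.mem_unitaryGroup_iff'.1 hW
  refine ⟨W.mulVec ψ, ?_, ?_⟩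
  · rw [IsUnitVector, Matrix.star_mulVec, ← Matrix.dotProduct_mulVec, Matrix.mulVec_mulVec, hWW,
      Matrix.one_mulVec]
    simp only [dotProduct, Pi.star_apply, hψ]
    exact_mod_cast hw1
  · rw [Matrix.star_mulVec, ← Matrix.dotProduct_mulVec, Matrix.mulVec_mulVec, Matrix.mulVec_mulVec,
      ← mul_assoc, ← mul_assoc, hWW, one_mul, mul_assoc, hWW, mul_one, ← hwz]
    simp only [dotProduct, Pi.star_apply, Matrix.mulVec_diagonal, Complex.real_smul]
    refine Finset.sum_congr rfl fun i _ => ?_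
    rw [← hψ]; ring

end Matrix

/-! ### The scalar problem with priors in either order -/

lemma success_le_pureOptimum {η : Fin 2 → ℝ} (hη : ∀ i, 0 ≤ η i) (hη1 : η 0 + η 1 = 1)
    {m S : ℝ} (hS0 : 0 ≤ S) (hS : S ≤ 1) {x y : Option (Fin 2) → ℝ} (hx : ∑ μ, x μ ^ 2 = η 0)
    (hy : ∑ μ, y μ ^ 2 = η 1) (h : √(η 0 * η 1 * S) ≤ ∑ μ, x μ * y μ)
    (he : x (some 1) ^ 2 + y (some 0) ^ 2 ≤ m) :
    x (some 0) ^ 2 + y (some 1) ^ 2 ≤ pureOptimum η m S := by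
  simp only [Fintype.sum_option, Fin.sum_univ_two] at hx hy h
  unfold pureOptimum
  rcases le_total (η 0) (η 1) with hle | hle
  · rw [min_eq_left hle, max_eq_right hle]
    exact success_le_threeDomainFormula (x₃ := x none) (y₃ := y none) (hη 0) hle hη1 hS0 hS
      (by linarith) (by linarith) (by linarith) he
  · rw [min_eq_right hle, max_eq_left hle]
    rw [mul_comm (η 0)] at h
    rw [add_comm] at he ⊢
    exact success_le_threeDomainFormula (x₃ := y none) (y₃ := x none) (hη 1) hle (by linarith) hS0
      hS (by linarith) (by linarith) (by linarith) he

lemma exists_amplitudes_pureOptimum {η : Fin 2 → ℝ} (hη : ∀ i, 0 ≤ η i) (hη1 : η 0 + η 1 = 1)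
    {m S : ℝ} (hS0 : 0 ≤ S) (hS : S ≤ 1) (hm : 0 ≤ m) :
    ∃ x y : Option (Fin 2) → ℝ, ∑ μ, x μ ^ 2 = 1 ∧ ∑ μ, y μ ^ 2 = 1 ∧ ∑ μ, x μ * y μ = √S ∧
      η 0 * x (some 1) ^ 2 + η 1 * y (some 0) ^ 2 ≤ m ∧
      η 0 * x (some 0) ^ 2 + η 1 * y (some 1) ^ 2 = pureOptimum η m S := by
  simp only [Fintype.sum_option, Fin.sum_univ_two]
  unfold pureOptimum
  rcases le_total (η 0) (η 1) with hle | hle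
  · rw [min_eq_left hle, max_eq_right hle]
    obtain ⟨x₁, x₂, x₃, y₁, y₂, y₃, hx, hy, hxy, he, hs⟩ :=
      exists_amplitudes (hη 0) hle hη1 hS0 hS hm
    refine ⟨fun μ => μ.elim x₃ ![x₁, x₂], fun μ => μ.elim y₃ ![y₁, y₂], ?_⟩
    simp only [Option.elim, Matrix.cons_val_zero, Matrix.cons_val_one]
    exact ⟨by linarith, by linarith, by linarith, he, hs⟩
  · rw [min_eq_right hle, max_eq_left hle]
    obtain ⟨x₁, x₂, x₃, y₁, y₂, y₃, hx, hy, hxy, he, hs⟩ :=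
      exists_amplitudes (hη 1) hle (by linarith) hS0 hS hm
    refine ⟨fun μ => μ.elim y₃ ![y₂, y₁], fun μ => μ.elim x₃ ![x₂, x₁], ?_⟩
    simp only [Option.elim, Matrix.cons_val_zero, Matrix.cons_val_one]
    exact ⟨by linarith, by linarith, by linarith, by linarith, by linarith⟩

/-! ### The overlap constraint on outcome probabilities -/

section Matrix

variable {n : Type*} [Fintype n]

lemma trace_conjTranspose_mul_eq_inner {k l : Type*} [Fintype k] [Fintype l]
    (A B : Matrix k l ℂ) : (A.conjTranspose * B).trace =
      inner ℂ (WithLp.toLp 2 fun p : k × l => A p.1 p.2)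
        (WithLp.toLp 2 fun p : k × l => B p.1 p.2) := by
  simp only [PiLp.inner_apply, RCLike.inner_apply, Matrix.trace, Matrix.diag_apply,
    Matrix.mul_apply, Matrix.conjTranspose_apply, Fintype.sum_prod_type]
  rw [Finset.sum_comm]
  exact Finset.sum_congr rfl fun i _ => Finset.sum_congr rfl fun j _ => mul_comm _ _

/-- Cauchy–Schwarz for the Hilbert–Schmidt inner product. -/
lemma norm_trace_conjTranspose_mul_le {k l : Type*} [Fintype k] [Fintype l]
    (A B : Matrix k l ℂ) : ‖(A.conjTranspose * B).trace‖ ≤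
      √(A.conjTranspose * A).trace.re * √(B.conjTranspose * B).trace.re := by
  have h : ∀ v : EuclideanSpace ℂ (k × l), √(inner ℂ v v).re = ‖v‖ := fun v =>
    (norm_eq_sqrt_re_inner (𝕜 := ℂ) v).symm
  rw [trace_conjTranspose_mul_eq_inner A A, trace_conjTranspose_mul_eq_inner B B, h, h,
    trace_conjTranspose_mul_eq_inner]
  exact norm_inner_le_norm _ _

open scoped MatrixOrder in
lemma Matrix.PosSemidef.exists_eq_conjTranspose_mul_self [DecidableEq n] {A : Matrix n n ℂ}
    (hA : A.PosSemidef) :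
    ∃ D : Matrix n n ℂ, A = D.conjTranspose * D :=
  CStarAlgebra.nonneg_iff_eq_star_mul_self.mp hA.nonneg

lemma trace_mul_nonneg_of_posSemidef [DecidableEq n] {A B : Matrix n n ℂ} (hA : A.PosSemidef)
    (hB : B.PosSemidef) : 0 ≤ (A * B).trace.re := by
  obtain ⟨D, rfl⟩ := hB.exists_eq_conjTranspose_mul_self
  rw [← mul_assoc, Matrix.trace_mul_comm, ← mul_assoc]
  exact (Complex.nonneg_iff.1 (hA.mul_mul_conjTranspose_same D).trace_nonneg).1

/-- A measurement cannot decrease the fidelity: the amplitude `tr (ρ A† B)` is bounded by the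
Bhattacharyya coefficient of the outcome distributions. -/
theorem norm_trace_le_sum_sqrt_mul_sqrt [DecidableEq n] {ι : Type*} [Fintype ι]
    {ρ : Matrix n n ℂ} (hρ : ρ.PosSemidef) {E : Option ι → Matrix n n ℂ} (hE : IsPOVM E)
    (A B : Matrix n n ℂ) :
    ‖(ρ * (A.conjTranspose * B)).trace‖ ≤ ∑ μ, √(A * ρ * A.conjTranspose * E μ).trace.re *
      √(B * ρ * B.conjTranspose * E μ).trace.re := by
  obtain ⟨C, hC⟩ := hρ.exists_eq_conjTranspose_mul_self
  choose D hD using fun μ => (hE.1 μ).exists_eq_conjTranspose_mul_self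
  have key : ∀ (A B : Matrix n n ℂ) μ, ((D μ * A * C.conjTranspose).conjTranspose *
      (D μ * B * C.conjTranspose)).trace = (ρ * (A.conjTranspose * E μ * B)).trace := by
    intro A B μ
    rw [hC, hD μ, mul_assoc C.conjTranspose, Matrix.trace_mul_comm C.conjTranspose]
    simp only [Matrix.conjTranspose_mul, Matrix.conjTranspose_conjTranspose, mul_assoc]
  have key' : ∀ (A : Matrix n n ℂ) μ, (ρ * (A.conjTranspose * E μ * A)).trace
      = (A * ρ * A.conjTranspose * E μ).trace := by
    intro A μ
    rw [← mul_assoc, Matrix.trace_mul_comm]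
    simp only [mul_assoc]
  have hsum : (ρ * (A.conjTranspose * B)).trace
      = ∑ μ, (ρ * (A.conjTranspose * E μ * B)).trace := by
    rw [← Matrix.trace_sum, ← Finset.mul_sum, ← Finset.sum_mul, ← Finset.mul_sum, hE.2, mul_one]
  rw [hsum]
  refine (norm_sum_le _ _).trans (Finset.sum_le_sum fun μ _ => ?_)
  rw [← key, ← key', ← key', ← key, ← key]
  exact norm_trace_conjTranspose_mul_le _ _

lemma errorProb_fin_two (η : Fin 2 → ℝ) (U : Fin 2 → Matrix n n ℂ) (ρ : Matrix n n ℂ)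
    (E : Option (Fin 2) → Matrix n n ℂ) : errorProb η U ρ E =
      jointProb η U ρ E 0 (some 1) + jointProb η U ρ E 1 (some 0) := by
  have h0 : Finset.univ.erase (0 : Fin 2) = {1} := by decide
  have h1 : Finset.univ.erase (1 : Fin 2) = {0} := by decide
  rw [errorProb, Fin.sum_univ_two, h0, h1, Finset.sum_singleton, Finset.sum_singleton]

lemma successProb_fin_two (η : Fin 2 → ℝ) (U : Fin 2 → Matrix n n ℂ) (ρ : Matrix n n ℂ)
    (E : Option (Fin 2) → Matrix n n ℂ) : successProb η U ρ E =
      jointProb η U ρ E 0 (some 0) + jointProb η U ρ E 1 (some 1) := by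
  simp [successProb]

/-- The upper bound on the success probability, for pure and mixed inputs alike. -/
theorem successProb_le_pureOptimum [DecidableEq n] {U : Fin 2 → Matrix n n ℂ}
    (hU : ∀ i, U i ∈ Matrix.unitaryGroup n ℂ) {η : Fin 2 → ℝ} (hη : ∀ i, 0 ≤ η i)
    (hη1 : η 0 + η 1 = 1) {ρ : Matrix n n ℂ} (hρ : IsDensityMatrix ρ)
    {E : Option (Fin 2) → Matrix n n ℂ} (hE : IsPOVM E) {m S : ℝ} (hS0 : 0 ≤ S) (hS1 : S ≤ 1)
    (hS : S ≤ ‖(ρ * ((U 0).conjTranspose * U 1)).trace‖ ^ 2) (hm : errorProb η U ρ E ≤ m) :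
    successProb η U ρ E ≤ pureOptimum η m S := by
  have hp : ∀ i μ, 0 ≤ (U i * ρ * (U i).conjTranspose * E μ).trace.re := fun i μ =>
    trace_mul_nonneg_of_posSemidef (hρ.1.mul_mul_conjTranspose_same (U i)) (hE.1 μ)
  have hj : ∀ i μ, √(jointProb η U ρ E i μ) ^ 2 = jointProb η U ρ E i μ := fun i μ =>
    Real.sq_sqrt (mul_nonneg (hη i) (hp i μ))
  have hsum : ∀ i, ∑ μ, √(jointProb η U ρ E i μ) ^ 2 = η i := by
    intro i
    simp only [hj]
    simp only [jointProb, ← Finset.mul_sum]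
    rw [← Complex.re_sum, ← Matrix.trace_sum, ← Finset.mul_sum, hE.2, mul_one,
      Matrix.trace_mul_comm, ← mul_assoc, ← Matrix.star_eq_conjTranspose,
      Matrix.mem_unitaryGroup_iff'.1 (hU i), one_mul, hρ.2]
    simp
  rw [successProb_fin_two, ← hj 0, ← hj 1]
  refine success_le_pureOptimum hη hη1 hS0 hS1 (hsum 0) (hsum 1) ?_ ?_
  · have h1 : √S ≤ ‖(ρ * ((U 0).conjTranspose * U 1)).trace‖ :=
      (Real.sqrt_le_left (norm_nonneg _)).2 hS
    have h2 := h1.trans (norm_trace_le_sum_sqrt_mul_sqrt hρ.1 hE (U 0) (U 1))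
    have h3 := mul_le_mul_of_nonneg_left h2 (mul_nonneg (Real.sqrt_nonneg (η 0))
      (Real.sqrt_nonneg (η 1)))
    rw [Real.sqrt_mul (mul_nonneg (hη 0) (hη 1)), Real.sqrt_mul (hη 0)]
    refine h3.trans (le_of_eq ?_)
    rw [Finset.mul_sum]
    refine Finset.sum_congr rfl fun μ _ => ?_
    simp only [jointProb]
    rw [Real.sqrt_mul (hη 0), Real.sqrt_mul (hη 1)]
    ring
  · rw [hj, hj, ← errorProb_fin_two]
    exact hm

end Matrix

/-! ### Measurements with prescribed amplitudes -/

section Matrix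

variable {n : Type*} [Fintype n]

/-- Two pairs of unit vectors with the same overlap are related by a contraction: a partial
isometry that vanishes off the span of the first pair. -/
theorem exists_contraction_of_overlap_eq [DecidableEq n] {k : Type*} [Fintype k] {u v : n → ℂ}
    {a b : k → ℂ} (hu : IsUnitVector u) (hv : IsUnitVector v) (ha : IsUnitVector a)
    (hb : IsUnitVector b) (hg : star u ⬝ᵥ v = star a ⬝ᵥ b) :
    ∃ L : Matrix k n ℂ, L.mulVec u = a ∧ L.mulVec v = b ∧
      (1 - L.conjTranspose * L).PosSemidef := by
  unfold IsUnitVector at hu hv ha hb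
  set g := star u ⬝ᵥ v with hgdef
  have hg' : star v ⬝ᵥ u = star g := by rw [hgdef, Matrix.star_dotProduct]
  have hg'' : star b ⬝ᵥ a = star g := by rw [hg, Matrix.star_dotProduct]
  set w := v - g • u with hw
  set d := b - g • a with hd
  set r : ℂ := 1 - star g * g with hr
  have huw : star u ⬝ᵥ w = 0 := by
    rw [hw, dotProduct_sub, dotProduct_smul, hu, ← hgdef]; simp
  have hwu : star w ⬝ᵥ u = 0 := by
    rw [hw, star_sub, star_smul, sub_dotProduct, smul_dotProduct, hu, hg']; simp
  have had : star a ⬝ᵥ d = 0 := by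
    rw [hd, dotProduct_sub, dotProduct_smul, ha, ← hg]; simp
  have hda : star d ⬝ᵥ a = 0 := by
    rw [hd, star_sub, star_smul, sub_dotProduct, smul_dotProduct, ha, hg'']; simp
  have hwv : star w ⬝ᵥ v = r := by
    rw [hw, star_sub, star_smul, sub_dotProduct, smul_dotProduct, hv, ← hgdef]; simp [hr]
  have hww : star w ⬝ᵥ w = r := by
    conv_lhs => arg 2; rw [hw]
    rw [dotProduct_sub, dotProduct_smul, hwu, hwv]; simp
  have hdb : star d ⬝ᵥ b = r := by
    rw [hd, star_sub, star_smul, sub_dotProduct, smul_dotProduct, hb, ← hg]; simp [hr]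
  have hdd : star d ⬝ᵥ d = r := by
    conv_lhs => arg 2; rw [hd]
    rw [dotProduct_sub, dotProduct_smul, hda, hdb]; simp
  -- if `r = 0`, then `w = 0` and `d = 0`, and the second term below is absent since `0⁻¹ = 0`
  have hrd : (r⁻¹ * r) • d = d := by
    by_cases h0 : r = 0
    · rw [h0] at hdd
      have hd0 : d = 0 := dotProduct_star_self_eq_zero.1 hdd
      rw [hd0, smul_zero]
    · rw [inv_mul_cancel₀ h0, one_smul]
  have hrs : star r = r := by simp [hr, mul_comm]
  set P : Matrix n n ℂ := Matrix.vecMulVec u (star u) + r⁻¹ • Matrix.vecMulVec w (star w) with hP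
  have hPP : P * P = P := by
    rw [hP]
    simp only [mul_add, add_mul, Matrix.smul_mul, Matrix.mul_smul, Matrix.vecMulVec_mul_vecMulVec,
      hu, huw, hwu, hww, smul_smul, zero_smul, Matrix.vecMulVec_zero, smul_zero, add_zero, zero_add,
      one_smul, Matrix.vecMulVec_smul]
    congr 2
    by_cases h0 : r = 0
    · simp [h0]
    · field_simp
  have hPH : P.conjTranspose = P := by
    rw [hP]
    simp [Matrix.conjTranspose_add, Matrix.conjTranspose_smul, Matrix.conjTranspose_vecMulVec, hrs]
  refine ⟨Matrix.vecMulVec a (star u) + r⁻¹ • Matrix.vecMulVec d (star w), ?_, ?_, ?_⟩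
  · rw [Matrix.add_mulVec, Matrix.smul_mulVec, Matrix.vecMulVec_mulVec, Matrix.vecMulVec_mulVec,
      hu, hwu]
    simp
  · rw [Matrix.add_mulVec, Matrix.smul_mulVec, Matrix.vecMulVec_mulVec, Matrix.vecMulVec_mulVec,
      ← hgdef, hwv, op_smul_eq_smul, op_smul_eq_smul, smul_smul, hrd, hd]
    simp
  · have hLL : (Matrix.vecMulVec a (star u) + r⁻¹ • Matrix.vecMulVec d (star w)).conjTranspose *
        (Matrix.vecMulVec a (star u) + r⁻¹ • Matrix.vecMulVec d (star w)) = P := by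
      rw [hP]
      simp only [Matrix.conjTranspose_add, Matrix.conjTranspose_smul,
        Matrix.conjTranspose_vecMulVec, star_star, star_inv₀, hrs, Matrix.mul_add,
        Matrix.add_mul,        Matrix.smul_mul, Matrix.mul_smul, Matrix.vecMulVec_mul_vecMulVec,
        ha, had, hda, hdd, smul_smul, zero_smul, Matrix.vecMulVec_zero, smul_zero, add_zero,
        zero_add, one_smul, Matrix.vecMulVec_smul]
      congr 2
      by_cases h0 : r = 0
      · simp [h0]
      · field_simp
    rw [hLL]
    have : (1 - P) = (1 - P).conjTranspose * (1 - P) := by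
      rw [Matrix.conjTranspose_sub, Matrix.conjTranspose_one, hPH]
      simp [mul_sub, sub_mul, hPP]
    rw [this]
    exact Matrix.posSemidef_conjTranspose_mul_self _

/-- The POVM obtained by applying a contraction `L`, measuring in the standard basis, and counting
the defect `1 - L† L` as inconclusive. -/
lemma exists_povm_of_contraction [DecidableEq n] {ι : Type*} [Fintype ι] [DecidableEq ι]
    {L : Matrix (Option ι) n ℂ} (hL : (1 - L.conjTranspose * L).PosSemidef) :
    ∃ E : Option ι → Matrix n n ℂ, IsPOVM E ∧ ∀ (i : ι) (u : n → ℂ),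
      star u ⬝ᵥ (E (some i)).mulVec u = ((‖L.mulVec u (some i)‖ ^ 2 : ℝ) : ℂ) := by
  let F : Option ι → Matrix n n ℂ := fun μ =>
    L.conjTranspose * Matrix.diagonal (Pi.single μ (1 : ℂ)) * L
  have hF : ∀ μ, (F μ).PosSemidef := fun μ =>
    (Matrix.PosSemidef.diagonal (Pi.single_nonneg.2 zero_le_one)).conjTranspose_mul_mul_same L
  have hFsum : ∑ μ, F μ = L.conjTranspose * L := by
    simp only [F]
    rw [← Matrix.sum_mul, ← Matrix.mul_sum]
    have : ∑ μ : Option ι, Matrix.diagonal (Pi.single μ (1 : ℂ)) = 1 := by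
      ext i j
      rw [Matrix.sum_apply, Matrix.one_apply]
      by_cases hij : i = j
      · subst hij
        simp [Pi.single_apply]
      · simp [hij]
    rw [this, Matrix.mul_one]
  refine ⟨fun μ => F μ + if μ = none then 1 - L.conjTranspose * L else 0, ⟨fun μ => ?_, ?_⟩, ?_⟩
  · refine (hF μ).add ?_
    split_ifs
    · exact hL
    · exact Matrix.PosSemidef.zero
  · rw [Finset.sum_add_distrib, hFsum, Finset.sum_ite_eq' Finset.univ none]
    simp
  · intro i u
    simp only [reduceCtorEq, if_false, add_zero, F]
    rw [← Matrix.mulVec_mulVec, ← Matrix.mulVec_mulVec, Matrix.dotProduct_mulVec,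
      ← Matrix.star_mulVec]
    simp only [dotProduct, Matrix.mulVec_diagonal, Pi.star_apply, Pi.single_apply]
    simp [Complex.conj_mul']

lemma exists_povm_of_amplitudes [DecidableEq n] {ι : Type*} [Fintype ι] [DecidableEq ι]
    {u v : n → ℂ} (hu : IsUnitVector u) (hv : IsUnitVector v) {x y : Option ι → ℝ}
    (hx : ∑ μ, x μ ^ 2 = 1) (hy : ∑ μ, y μ ^ 2 = 1) (hxy : ∑ μ, x μ * y μ = ‖star u ⬝ᵥ v‖) :
    ∃ E : Option ι → Matrix n n ℂ, IsPOVM E ∧ ∀ i : ι,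
      star u ⬝ᵥ (E (some i)).mulVec u = ((x (some i) ^ 2 : ℝ) : ℂ) ∧
      star v ⬝ᵥ (E (some i)).mulVec v = ((y (some i) ^ 2 : ℝ) : ℂ) := by
  -- the phase of the overlap is absorbed into the amplitudes of `v`
  obtain ⟨ω, hω1, hω⟩ : ∃ ω : ℂ, ‖ω‖ = 1 ∧ (‖star u ⬝ᵥ v‖ : ℂ) * ω = star u ⬝ᵥ v :=
    ⟨Complex.exp ((star u ⬝ᵥ v).arg * Complex.I), Complex.norm_exp_ofReal_mul_I _,
      Complex.norm_mul_exp_arg_mul_I _⟩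
  have hωω : star ω * ω = 1 := by
    rw [RCLike.star_def, Complex.conj_mul', hω1]; simp
  have ha : IsUnitVector fun μ => (x μ : ℂ) := by
    simp only [IsUnitVector, dotProduct, Pi.star_apply, RCLike.star_def, Complex.conj_ofReal]
    exact_mod_cast (by simpa [sq] using hx)
  have hb : IsUnitVector fun μ => (y μ : ℂ) * ω := by
    have : ∀ μ, star ((y μ : ℂ) * ω) * ((y μ : ℂ) * ω) = ((y μ ^ 2 : ℝ) : ℂ) := by
      intro μ
      rw [star_mul', RCLike.star_def, Complex.conj_ofReal, ← RCLike.star_def]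
      calc _ = (y μ : ℂ) ^ 2 * (star ω * ω) := by ring
        _ = _ := by rw [hωω, mul_one]; push_cast; rfl
    simp only [IsUnitVector, dotProduct, Pi.star_apply, this]
    exact_mod_cast hy
  obtain ⟨L, hLu, hLv, hL⟩ := exists_contraction_of_overlap_eq hu hv ha hb (by
    simp only [dotProduct, Pi.star_apply, RCLike.star_def, Complex.conj_ofReal, ← mul_assoc]
    rw [← Finset.sum_mul]
    change star u ⬝ᵥ v = _
    rw [← hω, ← hxy]
    push_cast
    rfl)
  obtain ⟨E, hE, h⟩ := exists_povm_of_contraction hL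
  refine ⟨E, hE, fun i => ⟨?_, ?_⟩⟩
  · rw [h, hLu]; simp
  · rw [h, hLv]; simp [hω1]

/-! ### The optimum for a fixed pure input -/

lemma IsUnitVector.norm_dotProduct_le_one {u v : n → ℂ} (hu : IsUnitVector u)
    (hv : IsUnitVector v) : ‖star u ⬝ᵥ v‖ ≤ 1 := by
  have hnorm : ∀ w : n → ℂ, IsUnitVector w → ‖WithLp.toLp 2 w‖ = 1 := by
    intro w hw
    have : inner ℂ (WithLp.toLp 2 w) (WithLp.toLp 2 w) = (1 : ℂ) := by
      rw [EuclideanSpace.inner_eq_star_dotProduct, dotProduct_comm]; exact hw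
    rw [norm_eq_sqrt_re_inner (𝕜 := ℂ), this]; simp
  have h := norm_inner_le_norm (𝕜 := ℂ) (WithLp.toLp 2 u) (WithLp.toLp 2 v)
  rw [hnorm u hu, hnorm v hv, EuclideanSpace.inner_eq_star_dotProduct, dotProduct_comm,
    one_mul] at h
  exact h

lemma IsUnitVector.unitary_mulVec [DecidableEq n] {U : Matrix n n ℂ}
    (hU : U ∈ Matrix.unitaryGroup n ℂ) {φ : n → ℂ} (hφ : IsUnitVector φ) :
    IsUnitVector (U.mulVec φ) := by
  rw [IsUnitVector, Matrix.star_mulVec, ← Matrix.dotProduct_mulVec, Matrix.mulVec_mulVec,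
    ← Matrix.star_eq_conjTranspose, Matrix.mem_unitaryGroup_iff'.1 hU, Matrix.one_mulVec]
  exact hφ

lemma IsUnitVector.isDensityMatrix_pureState {φ : n → ℂ} (hφ : IsUnitVector φ) :
    IsDensityMatrix (pureState φ) :=
  ⟨Matrix.posSemidef_vecMulVec_self_star φ, by
    rw [pureState, Matrix.trace_vecMulVec, dotProduct_comm]; exact hφ⟩

lemma trace_pureState_mul (φ : n → ℂ) (A : Matrix n n ℂ) :
    (pureState φ * A).trace = star φ ⬝ᵥ A.mulVec φ := by
  rw [pureState, Matrix.vecMulVec_mul, Matrix.trace_vecMulVec, dotProduct_comm,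
    ← Matrix.dotProduct_mulVec]

lemma mul_pureState_mul_conjTranspose (U : Matrix n n ℂ) (φ : n → ℂ) :
    U * pureState φ * U.conjTranspose = pureState (U.mulVec φ) := by
  rw [pureState, pureState, Matrix.mul_vecMulVec, Matrix.vecMulVec_mul, Matrix.star_mulVec]

lemma dotProduct_conjTranspose_mul_mulVec (A B : Matrix n n ℂ) (φ : n → ℂ) :
    star φ ⬝ᵥ (A.conjTranspose * B).mulVec φ = star (A.mulVec φ) ⬝ᵥ B.mulVec φ := by
  rw [Matrix.star_mulVec, ← Matrix.mulVec_mulVec, Matrix.dotProduct_mulVec]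

theorem isGreatest_successSetOfInput [DecidableEq n] {U : Fin 2 → Matrix n n ℂ}
    (hU : ∀ i, U i ∈ Matrix.unitaryGroup n ℂ) {η : Fin 2 → ℝ} (hη : ∀ i, 0 ≤ η i)
    (hη1 : η 0 + η 1 = 1) {m : ℝ} (hm : 0 ≤ m) {φ : n → ℂ} (hφ : IsUnitVector φ) :
    IsGreatest (successSetOfInput η U m (pureState φ))
      (pureOptimum η m (‖star ((U 0).mulVec φ) ⬝ᵥ ((U 1).mulVec φ)‖ ^ 2)) := by
  have hu := hφ.unitary_mulVec (hU 0)
  have hv := hφ.unitary_mulVec (hU 1)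
  have hS1 : ‖star ((U 0).mulVec φ) ⬝ᵥ ((U 1).mulVec φ)‖ ^ 2 ≤ 1 :=
    pow_le_one₀ (norm_nonneg _) (hu.norm_dotProduct_le_one hv)
  constructor
  · obtain ⟨x, y, hx, hy, hxy, he, hs⟩ :=
      exists_amplitudes_pureOptimum hη hη1 (sq_nonneg _) hS1 hm
    rw [Real.sqrt_sq (norm_nonneg _)] at hxy
    obtain ⟨E, hE, h⟩ := exists_povm_of_amplitudes hu hv hx hy hxy
    have h0 : ∀ i, jointProb η U (pureState φ) E 0 (some i) = η 0 * x (some i) ^ 2 := by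
      intro i
      rw [jointProb, mul_pureState_mul_conjTranspose, trace_pureState_mul, (h i).1,
        Complex.ofReal_re]
    have h1 : ∀ i, jointProb η U (pureState φ) E 1 (some i) = η 1 * y (some i) ^ 2 := by
      intro i
      rw [jointProb, mul_pureState_mul_conjTranspose, trace_pureState_mul, (h i).2,
        Complex.ofReal_re]
    refine ⟨E, hE, ?_, ?_⟩
    · rw [errorProb_fin_two, h0, h1]; exact he
    · rw [successProb_fin_two, h0, h1]; exact hs.symm
  · rintro p ⟨E, hE, hm', rfl⟩
    refine successProb_le_pureOptimum hU hη hη1 hφ.isDensityMatrix_pureState hE (sq_nonneg _) hS1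
      ?_ hm'
    rw [trace_pureState_mul, dotProduct_conjTranspose_mul_mulVec]

end Matrix

/-! ### The minimal overlap -/

section Matrix

variable {n : Type*} [Fintype n] [DecidableEq n]

lemma conjTranspose_mul_mem_unitaryGroup {A B : Matrix n n ℂ} (hA : A ∈ Matrix.unitaryGroup n ℂ)
    (hB : B ∈ Matrix.unitaryGroup n ℂ) : A.conjTranspose * B ∈ Matrix.unitaryGroup n ℂ :=
  mul_mem (Unitary.star_mem hA) hB

variable {U : Fin 2 → Matrix n n ℂ} (hU : ∀ i, U i ∈ Matrix.unitaryGroup n ℂ)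
include hU

lemma infDist_eigenvalueHull_le {ρ : Matrix n n ℂ} (hρ : IsDensityMatrix ρ) :
    Metric.infDist (0 : ℂ) (eigenvalueHull U) ^ 2 ≤
      ‖(ρ * ((U 0).conjTranspose * U 1)).trace‖ ^ 2 := by
  have h := Metric.infDist_le_dist_of_mem (x := (0 : ℂ)) (trace_mul_mem_convexHull_spectrum
    (conjTranspose_mul_mem_unitaryGroup (hU 0) (hU 1)) hρ)
  rw [dist_zero_left] at h
  exact pow_le_pow_left₀ Metric.infDist_nonneg h 2

theorem isLeast_overlapSet [Nonempty n] :
    IsLeast (overlapSet U) (Metric.infDist (0 : ℂ) (eigenvalueHull U) ^ 2) := by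
  have hV := conjTranspose_mul_mem_unitaryGroup (hU 0) (hU 1)
  constructor
  · obtain ⟨W, hW, d, hd⟩ := exists_unitary_eq_diagonal hV
    have hspec : spectrum ℂ ((U 0).conjTranspose * U 1) = Set.range d := by
      rw [hd, spectrum_unitary_conj hW]
    have hcomp : IsCompact (eigenvalueHull U) := by
      rw [eigenvalueHull, hspec]
      exact (Set.finite_range d).isCompact_convexHull ℝ
    have hne : (eigenvalueHull U).Nonempty := by
      rw [eigenvalueHull, hspec, convexHull_nonempty_iff]
      exact Set.range_nonempty d
    obtain ⟨z, hz, hdist⟩ := hcomp.exists_infDist_eq_dist hne 0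
    obtain ⟨φ, hφ, h⟩ := exists_unit_vector_of_mem_convexHull_spectrum hV hz
    exact ⟨φ, hφ, by rw [hdist, dist_zero_left, h]⟩
  · rintro s ⟨φ, hφ, rfl⟩
    rw [← trace_pureState_mul]
    exact infDist_eigenvalueHull_le hU hφ.isDensityMatrix_pureState

lemma minOverlap_eq_infDist [Nonempty n] :
    minOverlap U = Metric.infDist (0 : ℂ) (eigenvalueHull U) ^ 2 :=
  (isLeast_overlapSet hU).csInf_eq

lemma minOverlap_mem_Icc [Nonempty n] : minOverlap U ∈ Set.Icc (0 : ℝ) 1 := by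
  obtain ⟨φ, hφ, h⟩ := (isLeast_overlapSet hU).1
  rw [minOverlap_eq_infDist hU, h]
  refine ⟨sq_nonneg _, pow_le_one₀ (norm_nonneg _) ?_⟩
  rw [dotProduct_conjTranspose_mul_mulVec]
  exact (hφ.unitary_mulVec (hU 0)).norm_dotProduct_le_one (hφ.unitary_mulVec (hU 1))

/-- Pure inputs of minimal overlap are optimal among all inputs. -/
theorem isGreatest_successSet [Nonempty n] {η : Fin 2 → ℝ} (hη : ∀ i, 0 ≤ η i)
    (hη1 : η 0 + η 1 = 1) {m : ℝ} (hm : 0 ≤ m) :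
    IsGreatest (pureSuccessSet η U m) (pureOptimum η m (minOverlap U)) ∧
      IsGreatest (successSet η U m) (pureOptimum η m (minOverlap U)) := by
  have hsub : pureSuccessSet η U m ⊆ successSet η U m := by
    rintro p ⟨φ, hφ, hp⟩
    exact ⟨pureState φ, hφ.isDensityMatrix_pureState, hp⟩
  have hmem : pureOptimum η m (minOverlap U) ∈ pureSuccessSet η U m := by
    obtain ⟨φ, hφ, h⟩ := (isLeast_overlapSet hU).1
    refine ⟨φ, hφ, ?_⟩
    rw [minOverlap_eq_infDist hU, h, dotProduct_conjTranspose_mul_mulVec]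
    exact (isGreatest_successSetOfInput hU hη hη1 hm hφ).1
  have hub : pureOptimum η m (minOverlap U) ∈ upperBounds (successSet η U m) := by
    rintro p ⟨ρ, hρ, E, hE, he, rfl⟩
    obtain ⟨h0, h1⟩ := minOverlap_mem_Icc hU
    refine successProb_le_pureOptimum hU hη hη1 hρ hE h0 h1 ?_ he
    rw [minOverlap_eq_infDist hU]
    exact infDist_eigenvalueHull_le hU hρ
  exact ⟨⟨hmem, fun p hp => hub (hsub hp)⟩, hsub hmem, hub⟩

/-! ### Ancillas -/

lemma withAncilla_mem_unitaryGroup {r : Type*} [Fintype r] [DecidableEq r] (i : Fin 2) :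
    withAncilla r U i ∈ Matrix.unitaryGroup (n × r) ℂ :=
  Matrix.kronecker_mem_unitary (hU i) (one_mem _)

/-- Tensoring with an ancilla only changes the multiplicities of the eigenvalues. -/
lemma eigenvalueHull_withAncilla {r : Type*} [Fintype r] [DecidableEq r] [Nonempty r] :
    eigenvalueHull (withAncilla r U) = eigenvalueHull U := by
  obtain ⟨W, hW, d, hd⟩ :=
    exists_unitary_eq_diagonal (conjTranspose_mul_mem_unitaryGroup (hU 0) (hU 1))
  have hW' : W ⊗ₖ (1 : Matrix r r ℂ) ∈ Matrix.unitaryGroup (n × r) ℂ :=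
    Matrix.kronecker_mem_unitary hW (one_mem _)
  have h : (withAncilla r U 0).conjTranspose * withAncilla r U 1 =
      (W ⊗ₖ (1 : Matrix r r ℂ)) * Matrix.diagonal (fun p => d p.1) *
        (W ⊗ₖ (1 : Matrix r r ℂ)).conjTranspose := by
    have hdiag : Matrix.diagonal (fun p : n × r => d p.1)
        = Matrix.diagonal d ⊗ₖ (1 : Matrix r r ℂ) := by
      rw [← Matrix.diagonal_one, Matrix.diagonal_kronecker_diagonal]
      simp
    rw [withAncilla, withAncilla, hdiag, Matrix.conjTranspose_kronecker,
      Matrix.conjTranspose_kronecker, ← Matrix.mul_kronecker_mul, ← Matrix.mul_kronecker_mul,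
      ← Matrix.mul_kronecker_mul, hd]
    simp
  rw [eigenvalueHull, eigenvalueHull, h, hd, spectrum_unitary_conj hW', spectrum_unitary_conj hW]
  congr 1
  ext z
  simp

lemma minOverlap_withAncilla [Nonempty n] {r : Type*} [Fintype r] [DecidableEq r] [Nonempty r] :
    minOverlap (withAncilla r U) = minOverlap U := by
  rw [minOverlap_eq_infDist (withAncilla_mem_unitaryGroup hU), eigenvalueHull_withAncilla hU,
    minOverlap_eq_infDist hU]

end Matrix

/-! ### Concavity and monotonicity of the optimum -/

/-- Every squared overlap occurs for the processes `1` and `diag(1, -1)` on a qubit. -/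
lemma exists_qubit_model {S : ℝ} (hS : S ∈ Set.Icc (0 : ℝ) 1) :
    ∃ U : Fin 2 → Matrix (Fin 2) (Fin 2) ℂ, (∀ i, U i ∈ Matrix.unitaryGroup (Fin 2) ℂ) ∧
      ∃ φ : Fin 2 → ℂ, IsUnitVector φ ∧
        ‖star ((U 0).mulVec φ) ⬝ᵥ ((U 1).mulVec φ)‖ ^ 2 = S := by
  have hc0 : 0 ≤ √S := Real.sqrt_nonneg S
  have hc1 : √S ≤ 1 := Real.sqrt_le_one.2 hS.2
  obtain ⟨p, hp⟩ : ∃ p : ℝ, p * p = (1 + √S) / 2 := ⟨_, Real.mul_self_sqrt (by linarith)⟩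
  obtain ⟨q, hq⟩ : ∃ q : ℝ, q * q = (1 - √S) / 2 := ⟨_, Real.mul_self_sqrt (by linarith)⟩
  refine ⟨![1, Matrix.diagonal ![1, -1]], ?_, ![(p : ℂ), (q : ℂ)], ?_, ?_⟩
  · intro i
    fin_cases i
    · exact one_mem _
    · rw [Matrix.mem_unitaryGroup_iff]
      ext i j
      fin_cases i <;> fin_cases j <;> simp [Matrix.star_eq_conjTranspose]
  · have : p * p + q * q = 1 := by rw [hp, hq]; ring
    simp only [IsUnitVector, dotProduct, Fin.sum_univ_two, Pi.star_apply, Matrix.cons_val_zero,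
      Matrix.cons_val_one, RCLike.star_def, Complex.conj_ofReal]
    exact_mod_cast this
  · have : p * p + -(q * q) = √S := by rw [hp, hq]; ring
    simp only [Matrix.cons_val_zero, Matrix.cons_val_one, Matrix.one_mulVec, dotProduct,
      Fin.sum_univ_two, Pi.star_apply, Matrix.mulVec_diagonal, RCLike.star_def,
      Complex.conj_ofReal]
    have h2 : (p : ℂ) * (1 * p) + q * (-1 * q) = ((√S : ℝ) : ℂ) := by
      rw [← this]; push_cast; ring
    rw [h2, Complex.norm_real, Real.norm_of_nonneg hc0, Real.sq_sqrt hS.1]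

lemma IsPOVM.convex_combination {ι n : Type*} [Fintype ι] [Fintype n] [DecidableEq n]
    {E F : Option ι → Matrix n n ℂ} (hE : IsPOVM E) (hF : IsPOVM F) {s t : ℝ} (hs : 0 ≤ s)
    (ht : 0 ≤ t) (hst : s + t = 1) : IsPOVM fun μ => (s : ℂ) • E μ + (t : ℂ) • F μ := by
  refine ⟨fun μ => ((hE.1 μ).smul (Complex.zero_le_real.2 hs)).add
    ((hF.1 μ).smul (Complex.zero_le_real.2 ht)), ?_⟩
  rw [Finset.sum_add_distrib, ← Finset.smul_sum, ← Finset.smul_sum, hE.2, hF.2, ← add_smul,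
    ← Complex.ofReal_add, hst, Complex.ofReal_one, one_smul]

lemma jointProb_convex_combination {ι n : Type*} [Fintype n] (η : ι → ℝ) (U : ι → Matrix n n ℂ)
    (ρ : Matrix n n ℂ) (E F : Option ι → Matrix n n ℂ) (s t : ℝ) (i : ι) (μ : Option ι) :
    jointProb η U ρ (fun μ => (s : ℂ) • E μ + (t : ℂ) • F μ) i μ =
      s * jointProb η U ρ E i μ + t * jointProb η U ρ F i μ := by
  simp only [jointProb, mul_add, Matrix.mul_smul, Matrix.trace_add, Matrix.trace_smul,
    Complex.add_re, smul_eq_mul, Complex.re_ofReal_mul]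
  ring

section Optimum

variable {η : Fin 2 → ℝ} (hη : ∀ i, 0 ≤ η i) (hη1 : η 0 + η 1 = 1)
include hη hη1

/-- Mixing two measurements mixes both the error and the success probability. -/
theorem concaveOn_pureOptimum {S : ℝ} (hS : S ∈ Set.Icc (0 : ℝ) 1) :
    ConcaveOn ℝ (Set.Icc (0 : ℝ) 1) fun m => pureOptimum η m S := by
  obtain ⟨U, hU, φ, hφ, rfl⟩ := exists_qubit_model hS
  refine ⟨convex_Icc 0 1, fun m₁ hm₁ m₂ hm₂ s t hs ht hst => ?_⟩
  obtain ⟨E, hE, he₁, h₁⟩ := (isGreatest_successSetOfInput hU hη hη1 hm₁.1 hφ).1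
  obtain ⟨F, hF, he₂, h₂⟩ := (isGreatest_successSetOfInput hU hη hη1 hm₂.1 hφ).1
  refine (isGreatest_successSetOfInput hU hη hη1
    (convex_Icc (0 : ℝ) 1 hm₁ hm₂ hs ht hst).1 hφ).2
    ⟨_, hE.convex_combination hF hs ht hst, ?_, ?_⟩
  · rw [errorProb_fin_two] at he₁ he₂ ⊢
    simp only [jointProb_convex_combination, smul_eq_mul]
    have := mul_le_mul_of_nonneg_left he₁ hs
    have := mul_le_mul_of_nonneg_left he₂ ht
    linarith
  · simp only [h₁, h₂, successProb_fin_two, jointProb_convex_combination, smul_eq_mul]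
    ring

theorem monotoneOn_pureOptimum {S : ℝ} (hS : S ∈ Set.Icc (0 : ℝ) 1) :
    MonotoneOn (fun m => pureOptimum η m S) (Set.Icc (0 : ℝ) 1) := by
  obtain ⟨U, hU, φ, hφ, rfl⟩ := exists_qubit_model hS
  intro m₁ hm₁ m₂ hm₂ hle
  obtain ⟨E, hE, he, h⟩ := (isGreatest_successSetOfInput hU hη hη1 hm₁.1 hφ).1
  exact (isGreatest_successSetOfInput hU hη hη1 hm₂.1 hφ).2 ⟨E, hE, he.trans hle, h⟩

/-- A larger overlap is a stronger constraint on the outcome probabilities. -/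
theorem antitoneOn_pureOptimum {m : ℝ} (hm : 0 ≤ m) :
    AntitoneOn (fun S => pureOptimum η m S) (Set.Icc (0 : ℝ) 1) := by
  intro S hS T hT hle
  obtain ⟨U, hU, φ, hφ, rfl⟩ := exists_qubit_model hT
  obtain ⟨E, hE, he, h⟩ := (isGreatest_successSetOfInput hU hη hη1 hm hφ).1
  simp only
  rw [h]
  refine successProb_le_pureOptimum hU hη hη1 hφ.isDensityMatrix_pureState hE hS.1 hS.2 ?_ he
  rwa [trace_pureState_mul, dotProduct_conjTranspose_mul_mulVec]

end Optimum

lemma pureOptimum_zero (η : Fin 2 → ℝ) {m : ℝ} (hm : 0 ≤ m) : pureOptimum η m 0 = 1 := by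
  simp [pureOptimum, threeDomainFormula, critMargin, hm]

theorem mainTheorem3 {n : Type*} [Fintype n] [DecidableEq n] [Nonempty n]
    (U : Fin 2 → Matrix n n ℂ) (hU : ∀ i, U i ∈ Matrix.unitaryGroup n ℂ)
    (η : Fin 2 → ℝ) (hη : ∀ i, 0 ≤ η i) (hη1 : η 0 + η 1 = 1) :
    -- `S_min` is attained, and is the squared distance from the origin to the eigenvalue hull
    IsLeast (overlapSet U) (minOverlap U) ∧
    minOverlap U = Metric.infDist (0 : ℂ) (eigenvalueHull U) ^ 2 ∧
    -- for a fixed pure input, `pureOptimum` is the optimum over all POVMs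
    (∀ m ∈ Set.Icc (0 : ℝ) 1, ∀ φ : n → ℂ, IsUnitVector φ →
      IsGreatest (successSetOfInput η U m (pureState φ))
        (pureOptimum η m (‖star ((U 0).mulVec φ) ⬝ᵥ ((U 1).mulVec φ)‖ ^ 2))) ∧
    -- `P_max(m) = P_max^pure(m) = P_max^pure(m, S_min)`
    (∀ m ∈ Set.Icc (0 : ℝ) 1,
      IsGreatest (pureSuccessSet η U m) (pureOptimum η m (minOverlap U)) ∧
      IsGreatest (successSet η U m) (pureOptimum η m (minOverlap U))) ∧
    -- concavity and monotonicity of `P_max^pure(m, S)`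
    (∀ S ∈ Set.Icc (0 : ℝ) 1,
      ConcaveOn ℝ (Set.Icc (0 : ℝ) 1) (fun m => pureOptimum η m S) ∧
      MonotoneOn (fun m => pureOptimum η m S) (Set.Icc (0 : ℝ) 1)) ∧
    (∀ m ∈ Set.Icc (0 : ℝ) 1,
      AntitoneOn (fun S => pureOptimum η m S) (Set.Icc (0 : ℝ) 1)) ∧
    -- if the hull contains the origin, discrimination is perfect
    (0 ∈ eigenvalueHull U → minOverlap U = 0 ∧
      ∀ m ∈ Set.Icc (0 : ℝ) 1, IsGreatest (successSet η U m) 1) ∧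
    -- an ancilla of any finite dimension, with arbitrary (possibly entangled) inputs and POVMs on
    -- the composite system, leaves `S_min` and the maximum success probability unchanged
    (∀ (r : Type*) [Fintype r] [DecidableEq r] [Nonempty r],
      minOverlap (withAncilla r U) = minOverlap U ∧
      ∀ m ∈ Set.Icc (0 : ℝ) 1,
        IsGreatest (pureSuccessSet η (withAncilla r U) m) (pureOptimum η m (minOverlap U)) ∧
        IsGreatest (successSet η (withAncilla r U) m) (pureOptimum η m (minOverlap U))) := by
  refine ⟨?_, minOverlap_eq_infDist hU, ?_, ?_, ?_, ?_, ?_, ?_⟩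
  · rw [minOverlap_eq_infDist hU]
    exact isLeast_overlapSet hU
  · exact fun m hm φ hφ => isGreatest_successSetOfInput hU hη hη1 hm.1 hφ
  · exact fun m hm => isGreatest_successSet hU hη hη1 hm.1
  · exact fun S hS => ⟨concaveOn_pureOptimum hη hη1 hS, monotoneOn_pureOptimum hη hη1 hS⟩
  · exact fun m hm => antitoneOn_pureOptimum hη hη1 hm.1
  · intro h0
    have hmin : minOverlap U = 0 := by
      rw [minOverlap_eq_infDist hU, Metric.infDist_zero_of_mem h0]
      norm_num
    refine ⟨hmin, fun m hm => ?_⟩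
    have h := (isGreatest_successSet hU hη hη1 hm.1).2
    rwa [hmin, pureOptimum_zero η hm.1] at h
  · intro r _ _ _
    refine ⟨minOverlap_withAncilla hU, fun m hm => ?_⟩
    rw [← minOverlap_withAncilla hU (r := r)]
    exact isGreatest_successSet (withAncilla_mem_unitaryGroup hU) hη hη1 hm.1
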